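/- **Setting.** Let $V:\mathbb R\to\mathbb R$ be smooth and even, with $V=V_{\rm per}+V_{\rm def}$, where $V_{\rm per}(x+1)=V_{\rm per}(x)$ for all $x$ and $V_{\rm def}(x)=0$ for $|x|>\rho$, for some $\rho\ge 0$. Let $\Phi\in L^2(\mathbb R)$, $\Phi\neq0$, be a bound state $-\Phi''+V\Phi=E\Phi$ with $E<0$; $\Phi$ is then either even or odd. For $z\in\mathbb C$ let $u_z,v_z$ be the solutions of $-y''+Vy=zy$ with $$u_z(0)=1,\ u_z'(0)=0,\ v_z(0)=0,\ v_z'(0)=1\quad\text{if }\Phi\text{ is even},$$ $$u_z(0)=0,\ u_z'(0)=1,\ v_z(0)=-1,\ v_z'(0)=0\quad\text{if }\Phi\text{ is odd}.$$ For $M>0$ and $z\in\mathbb C\setminus[0,\infty)$ let $\Theta(z)=\Theta_M(z)=u_z'(M)-i\sqrt z\,u_z(M)$, with the branch $\operatorname{Im}\sqrt z>0$. Let $H_{\rm trunc}=-\partial_x^2+V_{\rm trunc}$ on $L^2(\mathbb R)$, where $V_{\rm trunc}=V$ for $|x|\le M$ and $V_{\rm trunc}=0$ for $|x|>M$. **Theorem.**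 There is $k>0$ such that for every $\delta>0$ there are $M_0>\rho$ and $C$ such that for every $M\ge M_0$ satisfying the (uniform) nondegeneracy condition $$\bigl|v_E'(M)-i\sqrt E\,v_E(M)\bigr|\ \ge\ \delta\,\bigl(|v_E(M)|+|v_E'(M)|\bigr)$$ the following hold. 1. $\Theta$ has a unique root $E^*$ in the ball $\{z\in\mathbb C:\ |z-E|\le M^{-2}e^{-kM}\}$. 2. The root $E^*$ is real and negative, and it is an eigenvalue of $H_{\rm trunc}$. Moreover $\Theta$ is complex differentiable at $E$ with $\partial_z\Theta(E)\ne0$, and $$\Bigl|E^*-\Bigl(E-\frac{\Theta(E)}{\partial_z\Theta(E)}\Bigr)\Bigr|\le C\,e^{-4kM}.$$ -/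

import Mathlib

/-- `y` is the classical solution on `ℝ` of `(D_x² + V - z) y = 0`, that is `-y'' + V y = z y`,
with `y 0 = a` and `y' 0 = b`. -/
structure IsSchrodingerIVP (V : ℝ → ℝ) (z a b : ℂ) (y : ℝ → ℂ) : Prop where
  differentiable : Differentiable ℝ y
  differentiable_deriv : Differentiable ℝ (deriv y)
  equation : ∀ x, -deriv (deriv y) x + (V x : ℂ) * y x = z * y x
  value_zero : y 0 = a
  deriv_zero : deriv y 0 = b

/-- The terms of the Picard series of the initial value problem. -/
noncomputable def picardTerm (V : ℝ → ℝ) (z a b : ℂ) : ℕ → ℝ → ℂ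
  | 0 => fun x => a + b * x
  | n + 1 => fun x => ∫ s in (0 : ℝ)..x, ∫ t in (0 : ℝ)..s, ((V t : ℂ) - z) * picardTerm V z a b n t

/-- The derivatives of the terms of the Picard series. -/
noncomputable def picardTermDeriv (V : ℝ → ℝ) (z a b : ℂ) : ℕ → ℝ → ℂ
  | 0 => fun _ => b
  | n + 1 => fun s => ∫ t in (0 : ℝ)..s, ((V t : ℂ) - z) * picardTerm V z a b n t

/-- The second derivatives of the terms of the Picard series. -/
noncomputable def picardTermDeriv2 (V : ℝ → ℝ) (z a b : ℂ) : ℕ → ℝ → ℂ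
  | 0 => fun _ => 0
  | n + 1 => fun t => ((V t : ℂ) - z) * picardTerm V z a b n t

theorem continuous_picardTerm {V : ℝ → ℝ} (hV : Continuous V) (z a b : ℂ) (n : ℕ) :
    Continuous (picardTerm V z a b n) := by
  induction n with
  | zero => unfold picardTerm; fun_prop
  | succ n ih =>
    have h1 : Continuous fun t => ((V t : ℂ) - z) * picardTerm V z a b n t := by fun_prop
    have h2 : Continuous fun s => ∫ t in (0 : ℝ)..s, ((V t : ℂ) - z) * picardTerm V z a b n t :=
      intervalIntegral.continuous_primitive (fun _ _ => h1.intervalIntegrable _ _) 0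
    exact intervalIntegral.continuous_primitive (fun _ _ => h2.intervalIntegrable _ _) 0

theorem hasDerivAt_picardTermDeriv {V : ℝ → ℝ} (hV : Continuous V) (z a b : ℂ) (n : ℕ) (x : ℝ) :
    HasDerivAt (picardTermDeriv V z a b n) (picardTermDeriv2 V z a b n x) x := by
  cases n with
  | zero => exact hasDerivAt_const x b
  | succ n =>
    have h0 := continuous_picardTerm hV z a b n
    have h1 : Continuous fun t => ((V t : ℂ) - z) * picardTerm V z a b n t := by fun_prop
    exact intervalIntegral.integral_hasDerivAt_right (h1.intervalIntegrable _ _)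
      (h1.stronglyMeasurableAtFilter _ _) h1.continuousAt

theorem hasDerivAt_picardTerm {V : ℝ → ℝ} (hV : Continuous V) (z a b : ℂ) (n : ℕ) (x : ℝ) :
    HasDerivAt (picardTerm V z a b n) (picardTermDeriv V z a b n x) x := by
  cases n with
  | zero =>
    have h : HasDerivAt (fun x : ℝ => (x : ℂ)) 1 x := Complex.ofRealCLM.hasDerivAt
    simpa [picardTerm, picardTermDeriv] using (h.const_mul b).const_add a
  | succ n =>
    have h1 : Continuous (picardTermDeriv V z a b (n + 1)) :=
      continuous_iff_continuousAt.2 fun x => (hasDerivAt_picardTermDeriv hV z a b (n + 1) x).continuousAt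
    exact intervalIntegral.integral_hasDerivAt_right (h1.intervalIntegrable _ _)
      (h1.stronglyMeasurableAtFilter _ _) h1.continuousAt

theorem norm_primitive_le {f : ℝ → ℂ} {R B : ℝ} {n : ℕ}
    (hB : ∀ t, |t| ≤ R → ‖f t‖ ≤ B * |t| ^ n) {x : ℝ} (hx : |x| ≤ R) :
    ‖∫ t in (0 : ℝ)..x, f t‖ ≤ B * (|x| ^ (n + 1) / (n + 1)) := by
  rw [intervalIntegral.norm_integral_eq_norm_integral_uIoc]
  have h2 : ∫ t in Set.uIoc 0 x, B * |t - 0| ^ n = B * (|x - 0| ^ (n + 1) / (n + 1)) := by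
    rw [MeasureTheory.integral_const_mul, integral_pow_abs_sub_uIoc]
  simp only [sub_zero] at h2
  rw [← h2]
  have hint : MeasureTheory.IntegrableOn (fun t : ℝ => B * |t| ^ n) (Set.uIoc 0 x) := by
    have hc : Continuous fun t : ℝ => B * |t| ^ n := by fun_prop
    exact (intervalIntegrable_iff.1 (hc.intervalIntegrable 0 x))
  refine MeasureTheory.norm_integral_le_of_norm_le hint ?_
  refine (MeasureTheory.ae_restrict_iff' measurableSet_uIoc).2 (Filter.Eventually.of_forall ?_)
  intro t ht
  apply hB
  have := Set.abs_sub_left_of_mem_uIcc (Set.uIoc_subset_uIcc ht)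
  simp only [sub_zero] at this
  exact this.trans hx

theorem norm_picardTerm_le {V : ℝ → ℝ} {z : ℂ} (a b : ℂ) {R K : ℝ}
    (hR : 0 ≤ R) (hK : 0 ≤ K) (hVK : ∀ t, |t| ≤ R → ‖(V t : ℂ) - z‖ ≤ K) (n : ℕ) {x : ℝ}
    (hx : |x| ≤ R) :
    ‖picardTerm V z a b n x‖ ≤ (‖a‖ + ‖b‖ * R) * ((K * R) ^ n / n.factorial) * |x| ^ n := by
  induction n generalizing x with
  | zero =>
    simp only [picardTerm, pow_zero, Nat.factorial_zero, Nat.cast_one, div_one, mul_one]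
    refine (norm_add_le _ _).trans ?_
    rw [norm_mul, Complex.norm_real, Real.norm_eq_abs]
    gcongr
  | succ n ih =>
    have h1 : ∀ s, |s| ≤ R → ‖∫ t in (0 : ℝ)..s, ((V t : ℂ) - z) * picardTerm V z a b n t‖ ≤
        (K * R * ((‖a‖ + ‖b‖ * R) * ((K * R) ^ n / n.factorial))) * |s| ^ n := by
      intro s hs
      refine (norm_primitive_le (R := R) (n := n)
        (B := K * ((‖a‖ + ‖b‖ * R) * ((K * R) ^ n / n.factorial))) ?_ hs).trans ?_
      · intro t ht
        rw [norm_mul, mul_assoc]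
        gcongr
        · exact hVK t ht
        · exact ih ht
      · have h3 : |s| ^ (n + 1) / ((n : ℝ) + 1) ≤ R * |s| ^ n := by
          rw [div_le_iff₀ (by positivity), pow_succ]
          have h4 : |s| ^ n * |s| ≤ |s| ^ n * R := by gcongr
          have h5 : 0 ≤ R * |s| ^ n * n := by positivity
          nlinarith
        calc _ ≤ K * ((‖a‖ + ‖b‖ * R) * ((K * R) ^ n / n.factorial)) * (R * |s| ^ n) := by gcongr
          _ = _ := by ring
    refine (norm_primitive_le h1 hx).trans (le_of_eq ?_)
    rw [Nat.factorial_succ]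
    push_cast
    field_simp
    rw [pow_succ (K * R) n]
    ring

theorem exists_isSchrodingerIVP {V : ℝ → ℝ} (hV : Continuous V) (z a b : ℂ) :
    ∃ y, IsSchrodingerIVP V z a b y := by
  have key : ∀ x : ℝ, Summable (fun n => picardTerm V z a b n x) ∧
      HasDerivAt (fun x => ∑' n, picardTerm V z a b n x) (∑' n, picardTermDeriv V z a b n x) x ∧
      HasDerivAt (fun x => ∑' n, picardTermDeriv V z a b n x)
        (∑' n, picardTermDeriv2 V z a b n x) x := by
    intro x
    obtain ⟨R, hR⟩ : ∃ R, R = |x| + 1 := ⟨_, rfl⟩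
    have hR0 : 0 < R := by rw [hR]; positivity
    obtain ⟨K, hK⟩ : ∃ K, ∀ t ∈ Set.Icc (-R) R, ‖(V t : ℂ) - z‖ ≤ K :=
      isCompact_Icc.exists_bound_of_continuousOn (by fun_prop)
    have hVK : ∀ t, |t| ≤ R → ‖(V t : ℂ) - z‖ ≤ K := fun t ht => hK t (abs_le.1 ht)
    have hK0 : 0 ≤ K := (norm_nonneg _).trans (hVK 0 (by simp [hR0.le]))
    have hbd : ∀ n, ∀ t, |t| ≤ R → ‖picardTerm V z a b n t‖ ≤
        (‖a‖ + ‖b‖ * R) * ((K * R * R) ^ n / n.factorial) := by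
      intro n t ht
      refine (norm_picardTerm_le a b hR0.le hK0 hVK n ht).trans ?_
      calc _ ≤ (‖a‖ + ‖b‖ * R) * ((K * R) ^ n / n.factorial) * R ^ n := by gcongr
        _ = _ := by rw [mul_pow (K * R) R n]; ring
    have hsum : Summable fun n : ℕ =>
        (‖a‖ + ‖b‖ * R) * ((K * R * R) ^ n / n.factorial) :=
      (Real.summable_pow_div_factorial _).mul_left _
    have hbd2 : ∀ n, ∀ t, |t| ≤ R → ‖picardTermDeriv2 V z a b (n + 1) t‖ ≤
        K * ((‖a‖ + ‖b‖ * R) * ((K * R * R) ^ n / n.factorial)) := by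
      intro n t ht
      simp only [picardTermDeriv2, norm_mul]
      exact mul_le_mul (hVK t ht) (hbd n t ht) (norm_nonneg _) hK0
    have hbd1 : ∀ n, ∀ t, |t| ≤ R → ‖picardTermDeriv V z a b (n + 1) t‖ ≤
        R * (K * ((‖a‖ + ‖b‖ * R) * ((K * R * R) ^ n / n.factorial))) := by
      intro n t ht
      have h := norm_primitive_le (R := R) (n := 0) (f := picardTermDeriv2 V z a b (n + 1))
        (B := K * ((‖a‖ + ‖b‖ * R) * ((K * R * R) ^ n / n.factorial)))
        (fun t ht => by simpa using hbd2 n t ht) ht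
      refine h.trans ?_
      simp only [zero_add, pow_one, Nat.cast_zero, div_one]
      rw [mul_comm]
      gcongr
    have hxm : x ∈ Set.Ioo (-R) R := abs_lt.1 (by rw [hR]; linarith)
    have habs : ∀ {t}, t ∈ Set.Ioo (-R) R → |t| ≤ R := fun ht => (abs_lt.2 ht).le
    have hs1 : Summable (Nat.rec ‖b‖ fun n _ =>
        R * (K * ((‖a‖ + ‖b‖ * R) * ((K * R * R) ^ n / n.factorial))) : ℕ → ℝ) :=
      (summable_nat_add_iff 1).1 ((hsum.mul_left K).mul_left R)
    have hs2 : Summable (Nat.rec 0 fun n _ =>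
        K * ((‖a‖ + ‖b‖ * R) * ((K * R * R) ^ n / n.factorial)) : ℕ → ℝ) :=
      (summable_nat_add_iff 1).1 (hsum.mul_left K)
    have hsx : Summable fun n => picardTerm V z a b n x :=
      .of_norm_bounded hsum fun n => hbd n x (habs hxm)
    have hle1 : ∀ n t, t ∈ Set.Ioo (-R) R → ‖picardTermDeriv V z a b n t‖ ≤
        (Nat.rec ‖b‖ fun n _ =>
          R * (K * ((‖a‖ + ‖b‖ * R) * ((K * R * R) ^ n / n.factorial))) : ℕ → ℝ) n := by
      intro n t ht
      cases n with
      | zero => simp [picardTermDeriv]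
      | succ n => exact hbd1 n t (habs ht)
    have hle2 : ∀ n t, t ∈ Set.Ioo (-R) R → ‖picardTermDeriv2 V z a b n t‖ ≤
        (Nat.rec 0 fun n _ =>
          K * ((‖a‖ + ‖b‖ * R) * ((K * R * R) ^ n / n.factorial)) : ℕ → ℝ) n := by
      intro n t ht
      cases n with
      | zero => simp [picardTermDeriv2]
      | succ n => exact hbd2 n t (habs ht)
    refine ⟨hsx, ?_, ?_⟩
    · exact hasDerivAt_tsum_of_isPreconnected hs1 isOpen_Ioo isPreconnected_Ioo
        (fun n t _ => hasDerivAt_picardTerm hV z a b n t) hle1 hxm hsx hxm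
    · exact hasDerivAt_tsum_of_isPreconnected hs2 isOpen_Ioo isPreconnected_Ioo
        (fun n t _ => hasDerivAt_picardTermDeriv hV z a b n t) hle2 hxm
        (.of_norm_bounded hs1 fun n => hle1 n x hxm) hxm
  have hd : deriv (fun x => ∑' n, picardTerm V z a b n x) =
      fun x => ∑' n, picardTermDeriv V z a b n x := funext fun x => (key x).2.1.deriv
  refine ⟨fun x => ∑' n, picardTerm V z a b n x, fun x => (key x).2.1.differentiableAt, ?_, ?_,
    ?_, ?_⟩
  · rw [hd]
    exact fun x => (key x).2.2.differentiableAt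
  · intro x
    rw [hd, (key x).2.2.deriv]
    have h : ∑' n, picardTermDeriv2 V z a b n x =
        ((V x : ℂ) - z) * ∑' n, picardTerm V z a b n x := by
      have hs : Summable fun n => picardTermDeriv2 V z a b n x :=
        (summable_nat_add_iff 1).1 ((key x).1.mul_left ((V x : ℂ) - z))
      rw [hs.tsum_eq_zero_add, ← tsum_mul_left]
      simp [picardTermDeriv2]
    rw [h]
    ring
  · rw [(key 0).1.tsum_eq_zero_add]
    simp [picardTerm]
  · rw [hd]
    change ∑' n, picardTermDeriv V z a b n 0 = b
    rw [tsum_eq_single 0]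
    · rfl
    · intro n hn
      obtain ⟨m, rfl⟩ := Nat.exists_eq_succ_of_ne_zero hn
      simp [picardTermDeriv]

theorem IsSchrodingerIVP.unique {V : ℝ → ℝ} (hV : Continuous V) {z a b : ℂ} {y w : ℝ → ℂ}
    (hy : IsSchrodingerIVP V z a b y) (hw : IsSchrodingerIVP V z a b w) : y = w := by
  have hasD : ∀ {f : ℝ → ℂ}, IsSchrodingerIVP V z a b f → ∀ t,
      HasDerivAt (fun t => (f t, deriv f t))
        ((fun (t : ℝ) (p : ℂ × ℂ) => (p.2, ((V t : ℂ) - z) * p.1)) t (f t, deriv f t)) t := by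
    intro f hf t
    have h2 : deriv (deriv f) t = ((V t : ℂ) - z) * f t := by
      have := hf.equation t
      linear_combination -this
    have := (hf.differentiable t).hasDerivAt.prodMk (hf.differentiable_deriv t).hasDerivAt
    rw [h2] at this
    exact this
  funext x
  obtain ⟨R, hR⟩ : ∃ R, R = |x| + 1 := ⟨_, rfl⟩
  have hR0 : 0 < R := by rw [hR]; positivity
  obtain ⟨K, hK⟩ : ∃ K, ∀ t ∈ Set.Icc (-R) R, ‖(V t : ℂ) - z‖ ≤ K :=
    isCompact_Icc.exists_bound_of_continuousOn (by fun_prop)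
  have hlip : ∀ t ∈ Set.Ioo (-R) R, LipschitzOnWith (max 1 K.toNNReal)
      ((fun (t : ℝ) (p : ℂ × ℂ) => (p.2, ((V t : ℂ) - z) * p.1)) t) Set.univ := by
    intro t ht
    refine LipschitzOnWith.of_dist_le_mul fun p _ q _ => ?_
    have h1 : dist p.2 q.2 ≤ dist p q := le_max_right _ _
    have h2 : dist p.1 q.1 ≤ dist p q := le_max_left _ _
    have h3 : ((max 1 K.toNNReal : NNReal) : ℝ) = max 1 (max K 0) := by
      simp [Real.coe_toNNReal']
    rw [h3]
    refine max_le ?_ ?_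
    · exact h1.trans (le_mul_of_one_le_left dist_nonneg (le_max_left _ _))
    · simp only [dist_eq_norm] at h2 ⊢
      rw [← mul_sub, norm_mul]
      refine mul_le_mul ((hK t (Set.Ioo_subset_Icc_self ht)).trans ?_) h2 (norm_nonneg _)
        (by positivity)
      exact (le_max_left _ _).trans (le_max_right _ _)
  have hxm : x ∈ Set.Ioo (-R) R := abs_lt.1 (by rw [hR]; linarith)
  have h := ODE_solution_unique_of_mem_Ioo (t₀ := 0) hlip ⟨by linarith, hR0⟩
    (fun t _ => ⟨hasD hy t, Set.mem_univ _⟩) (fun t _ => ⟨hasD hw t, Set.mem_univ _⟩)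
    (by rw [hy.value_zero, hy.deriv_zero, hw.value_zero, hw.deriv_zero]) hxm
  exact congrArg Prod.fst h

open Classical in
/-- The solution of `-y'' + V y = z y` with `y 0 = a`, `y' 0 = b`; for continuous `V` it exists and
is unique, by the two theorems above. -/
noncomputable def schrodingerSol (V : ℝ → ℝ) (z a b : ℂ) : ℝ → ℂ :=
  if h : ∃ y, IsSchrodingerIVP V z a b y then h.choose else 0

theorem schrodingerSol_spec {V : ℝ → ℝ} (hV : Continuous V) (z a b : ℂ) :
    IsSchrodingerIVP V z a b (schrodingerSol V z a b) := by
  have h := exists_isSchrodingerIVP hV z a b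
  rw [schrodingerSol, dif_pos h]
  exact h.choose_spec

/-- The potential is smooth and is the sum of a `1`-periodic function and a function that vanishes
for `|x| > ρ`. -/
structure IsDefectPotential (V : ℝ → ℝ) (ρ : ℝ) : Prop where
  smooth : ContDiff ℝ (⊤ : ℕ∞) V
  radius_nonneg : 0 ≤ ρ
  decomposition : ∃ Vper Vdef : ℝ → ℝ, (∀ x, V x = Vper x + Vdef x) ∧
    (∀ x, Vper (x + 1) = Vper x) ∧ ∀ x, ρ < |x| → Vdef x = 0

/-- `Ψ` is a bound state, with eigenvalue `lam`, of `D_x² + W` acting on `L²(ℝ)`: it is a nonzero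
element of `L²(ℝ)`, it is differentiable, and its derivative is the primitive of `(W - lam) Ψ`,
so that `-Ψ'' + W Ψ = lam Ψ` almost everywhere. For bounded measurable `W` these are the
eigenfunctions of the self-adjoint operator with domain `H²(ℝ)`; for continuous `W` they are
classical solutions. -/
structure IsBoundState (W : ℝ → ℝ) (lam : ℝ) (Ψ : ℝ → ℂ) : Prop where
  memLp : MeasureTheory.MemLp Ψ 2 MeasureTheory.volume
  ne_zero : Ψ ≠ 0
  differentiable : Differentiable ℝ Ψ
  integrable : ∀ x y : ℝ, IntervalIntegrable (fun t => ((W t : ℂ) - lam) * Ψ t)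
    MeasureTheory.volume x y
  equation : ∀ x y : ℝ, deriv Ψ y - deriv Ψ x = ∫ t in x..y, ((W t : ℂ) - lam) * Ψ t

open Classical in
/-- The truncated potential: `V` for `|x| ≤ M` and `0` for `|x| > M`. -/
noncomputable def truncPotential (V : ℝ → ℝ) (M : ℝ) : ℝ → ℝ :=
  fun x => if |x| ≤ M then V x else 0

open Classical in
/-- `u_z`: the solution with `u_z 0 = 1`, `u_z' 0 = 0` if the bound state `Φ` is even, and with
`u_z 0 = 0`, `u_z' 0 = 1` otherwise (for even `V` a bound state is either even or odd). -/
noncomputable def uSol (V : ℝ → ℝ) (Φ : ℝ → ℂ) (z : ℂ) : ℝ → ℂ :=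
  if ∀ x, Φ (-x) = Φ x then schrodingerSol V z 1 0 else schrodingerSol V z 0 1

open Classical in
/-- `v_z`: the solution with `v_z 0 = 0`, `v_z' 0 = 1` if the bound state `Φ` is even, and with
`v_z 0 = -1`, `v_z' 0 = 0` otherwise. -/
noncomputable def vSol (V : ℝ → ℝ) (Φ : ℝ → ℂ) (z : ℂ) : ℝ → ℂ :=
  if ∀ x, Φ (-x) = Φ x then schrodingerSol V z 0 1 else schrodingerSol V z (-1) 0

/-- The branch of the square root on `ℂ ∖ [0, ∞)` with positive imaginary part. -/
noncomputable def sqrtUpper (z : ℂ) : ℂ := Complex.I * (-z) ^ (1 / 2 : ℂ)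

theorem sqrtUpper_sq (z : ℂ) : sqrtUpper z ^ 2 = z := by
  have h : ((-z) ^ (1 / 2 : ℂ)) ^ 2 = -z := by
    rw [one_div]
    exact_mod_cast Complex.cpow_nat_inv_pow (-z) (n := 2) two_ne_zero
  rw [sqrtUpper, mul_pow, h, Complex.I_sq]
  ring

theorem sqrtUpper_im_pos {z : ℂ} (hz : -z ∈ Complex.slitPlane) : 0 < (sqrtUpper z).im := by
  have h0 : -z ≠ 0 := Complex.slitPlane_ne_zero hz
  have harg : Complex.arg (-z) ≠ Real.pi := (Complex.mem_slitPlane_iff_arg.1 hz).1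
  have h1 := Complex.neg_pi_lt_arg (-z)
  have h2 := lt_of_le_of_ne (Complex.arg_le_pi (-z)) harg
  have h3 : (sqrtUpper z).im = ((-z) ^ (1 / 2 : ℂ)).re := by simp [sqrtUpper]
  have h4 : (Complex.log (-z) * (1 / 2)).im = Complex.arg (-z) / 2 := by
    rw [Complex.mul_im]
    simp [Complex.log_im]
    ring
  rw [h3, Complex.cpow_def_of_ne_zero h0, Complex.exp_re, h4]
  exact mul_pos (Real.exp_pos _) (Real.cos_pos_of_mem_Ioo ⟨by linarith, by linarith⟩)

/-- `Θ(z) = u_z'(M) - i √z u_z(M)`. -/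
noncomputable def Theta (V : ℝ → ℝ) (Φ : ℝ → ℂ) (M : ℝ) (z : ℂ) : ℂ :=
  deriv (uSol V Φ z) M - Complex.I * sqrtUpper z * uSol V Φ z M

/-!
If `y_z` solves `-y'' + V y = z y` with initial data independent of `z`, then `y_z` satisfies a
Volterra equation whose kernel is built from a fundamental pair `u`, `v` at the energy `E`. For
`u` the bound state, Floquet theory on the periodic part of `V` gives `λ > 0` such that `u` decays
like `exp (-λ x)` and `v` grows at most like `exp (λ x)`. Hence `Θ(E) = O(exp (-λ M))`, while
`∂_z Θ(E)` equals `-(v'(M) - i √E v(M)) ∫₀ᴹ u²` up to `O(M)`; the Wronskian forces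
`|v(M)| + |v'(M)|` to be at least of order `exp (λ M)`, so under the nondegeneracy condition
`∂_z Θ(E)` is of that order too. On a disc of radius of order `1 / M` about `E` the Volterra
equation also bounds `Θ` by `O(exp (λ M))`, which controls its second derivative there, and
Newton's method started at `E` gives the root together with its error; the theorem holds with
`k = λ / 2`. The root is real because `Θ` commutes with complex conjugation, and at a root `u` on
`[-M, M]` extends by decaying exponentials to a bound state of the truncated operator.
-/

section SchrodingerODE

open Set Filter Topology

/-- The Cauchy data `(y x, y' x)` of `y` at `x`; the norm on `ℂ × ℂ` is the maximum norm. -/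
noncomputable def cauchyData (y : ℝ → ℂ) (x : ℝ) : ℂ × ℂ := (y x, deriv y x)

/-- The Wronskian `y w' - y' w`. -/
noncomputable def wronskian (y w : ℝ → ℂ) (x : ℝ) : ℂ := y x * deriv w x - deriv y x * w x

theorem norm_le_norm_cauchyData (y : ℝ → ℂ) (x : ℝ) : ‖y x‖ ≤ ‖cauchyData y x‖ :=
  norm_fst_le (cauchyData y x)

theorem norm_deriv_le_norm_cauchyData (y : ℝ → ℂ) (x : ℝ) : ‖deriv y x‖ ≤ ‖cauchyData y x‖ :=
  norm_snd_le (cauchyData y x)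

theorem norm_wronskian_le (y w : ℝ → ℂ) (x : ℝ) :
    ‖wronskian y w x‖ ≤ 2 * ‖cauchyData y x‖ * ‖cauchyData w x‖ := by
  have h₁ : ‖y x * deriv w x‖ ≤ ‖cauchyData y x‖ * ‖cauchyData w x‖ :=
    norm_mul_le_of_le (norm_le_norm_cauchyData y x) (norm_deriv_le_norm_cauchyData w x)
  have h₂ : ‖deriv y x * w x‖ ≤ ‖cauchyData y x‖ * ‖cauchyData w x‖ :=
    norm_mul_le_of_le (norm_deriv_le_norm_cauchyData y x) (norm_le_norm_cauchyData w x)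
  exact (norm_sub_le_of_le h₁ h₂).trans_eq (by ring)

namespace IsSchrodingerIVP

variable {V : ℝ → ℝ} {z a b : ℂ} {y : ℝ → ℂ}

theorem hasDerivAt (hy : IsSchrodingerIVP V z a b y) (x : ℝ) : HasDerivAt y (deriv y x) x :=
  (hy.differentiable x).hasDerivAt

theorem hasDerivAt_deriv (hy : IsSchrodingerIVP V z a b y) (x : ℝ) :
    HasDerivAt (deriv y) (((V x : ℂ) - z) * y x) x :=
  (hy.differentiable_deriv x).hasDerivAt.congr_deriv (by linear_combination -(hy.equation x))

theorem continuous (hy : IsSchrodingerIVP V z a b y) : Continuous y :=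
  hy.differentiable.continuous

theorem continuous_deriv (hy : IsSchrodingerIVP V z a b y) : Continuous (deriv y) :=
  hy.differentiable_deriv.continuous

theorem continuous_cauchyData (hy : IsSchrodingerIVP V z a b y) : Continuous (cauchyData y) :=
  hy.continuous.prodMk hy.continuous_deriv

theorem of_hasDerivAt {y' : ℝ → ℂ} (h : ∀ x, HasDerivAt y (y' x) x)
    (h' : ∀ x, HasDerivAt y' (((V x : ℂ) - z) * y x) x) (ha : y 0 = a) (hb : y' 0 = b) :
    IsSchrodingerIVP V z a b y := by
  obtain rfl : deriv y = y' := funext fun x => (h x).deriv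
  refine ⟨fun x => (h x).differentiableAt, fun x => (h' x).differentiableAt, fun x => ?_, ha, hb⟩
  rw [(h' x).deriv]
  ring

theorem conj (hy : IsSchrodingerIVP V z a b y) :
    IsSchrodingerIVP V (starRingEnd ℂ z) (starRingEnd ℂ a) (starRingEnd ℂ b)
      (fun x => starRingEnd ℂ (y x)) := by
  refine of_hasDerivAt (y' := fun x => starRingEnd ℂ (deriv y x))
    (fun x => (hy.hasDerivAt x).star) (fun x => ?_) (by rw [hy.value_zero]) (by rw [hy.deriv_zero])
  exact (hy.hasDerivAt_deriv x).star.congr_deriv (by simp)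

theorem comp_neg (hEven : ∀ x, V (-x) = V x) (hy : IsSchrodingerIVP V z a b y) :
    IsSchrodingerIVP V z a (-b) (fun x => y (-x)) := by
  refine of_hasDerivAt (y' := fun x => -deriv y (-x)) (fun x => ?_) (fun x => ?_)
    (by simp [hy.value_zero]) (by simp [hy.deriv_zero])
  · exact ((hy.hasDerivAt (-x)).scomp x (hasDerivAt_neg x)).congr_deriv (by simp)
  · exact ((hy.hasDerivAt_deriv (-x)).scomp x (hasDerivAt_neg x)).neg.congr_deriv
      (by simp [hEven])

theorem const_mul (c : ℂ) (hy : IsSchrodingerIVP V z a b y) :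
    IsSchrodingerIVP V z (c * a) (c * b) (fun x => c * y x) :=
  of_hasDerivAt (y' := fun x => c * deriv y x) (fun x => (hy.hasDerivAt x).const_mul c)
    (fun x => ((hy.hasDerivAt_deriv x).const_mul c).congr_deriv (by ring))
    (by rw [hy.value_zero]) (by rw [hy.deriv_zero])

theorem add {a' b' : ℂ} {w : ℝ → ℂ} (hy : IsSchrodingerIVP V z a b y)
    (hw : IsSchrodingerIVP V z a' b' w) :
    IsSchrodingerIVP V z (a + a') (b + b') (fun x => y x + w x) :=
  of_hasDerivAt (y' := fun x => deriv y x + deriv w x)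
    (fun x => (hy.hasDerivAt x).add (hw.hasDerivAt x))
    (fun x => ((hy.hasDerivAt_deriv x).add (hw.hasDerivAt_deriv x)).congr_deriv (by ring))
    (by rw [hy.value_zero, hw.value_zero]) (by rw [hy.deriv_zero, hw.deriv_zero])

theorem wronskian_eq {z' a' b' : ℂ} {w : ℝ → ℂ}
    (hy : IsSchrodingerIVP V z a b y) (hw : IsSchrodingerIVP V z' a' b' w) (x : ℝ) :
    wronskian y w x = (a * b' - b * a') + (z - z') * ∫ t in (0 : ℝ)..x, y t * w t := by
  have hd (t : ℝ) : HasDerivAt (wronskian y w) ((z - z') * (y t * w t)) t :=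
    (((hy.hasDerivAt t).mul (hw.hasDerivAt_deriv t)).sub
      ((hy.hasDerivAt_deriv t).mul (hw.hasDerivAt t))).congr_deriv (by ring)
  have hc : Continuous fun t => (z - z') * (y t * w t) :=
    continuous_const.mul (hy.continuous.mul hw.continuous)
  have h := intervalIntegral.integral_eq_sub_of_hasDerivAt (a := 0) (b := x)
    (fun t _ => hd t) (hc.intervalIntegrable _ _)
  have h₀ : wronskian y w 0 = a * b' - b * a' := by
    rw [wronskian, hy.value_zero, hy.deriv_zero, hw.value_zero, hw.deriv_zero]
  rw [← intervalIntegral.integral_const_mul, h, h₀, add_sub_cancel]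

end IsSchrodingerIVP

/-- Two solutions `u`, `v` at the spectral parameter `z₀`, with initial data `(p, q)` and `(r, s)`
normalized so that their Wronskian is `1`. -/
structure IsFundamentalPair (V : ℝ → ℝ) (z₀ p q r s : ℂ) (u v : ℝ → ℂ) : Prop where
  left : IsSchrodingerIVP V z₀ p q u
  right : IsSchrodingerIVP V z₀ r s v
  det : p * s - q * r = 1

/-- The vector `(∫₀ˣ v y) (u, u')(x) - (∫₀ˣ u y) (v, v')(x)`: variation of constants produces it
from the source term `y`, so it drives the dependence of solutions on the spectral parameter. -/
noncomputable def volterraKernel (u v y : ℝ → ℂ) (x : ℝ) : ℂ × ℂ :=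
  (∫ t in (0 : ℝ)..x, v t * y t) • cauchyData u x - (∫ t in (0 : ℝ)..x, u t * y t) • cauchyData v x

theorem volterraKernel_sub {u v y w : ℝ → ℂ} (hu : Continuous u) (hv : Continuous v)
    (hy : Continuous y) (hw : Continuous w) (x : ℝ) :
    volterraKernel u v (fun t => y t - w t) x =
      volterraKernel u v y x - volterraKernel u v w x := by
  have h (f : ℝ → ℂ) (hf : Continuous f) : (∫ t in (0 : ℝ)..x, f t * (y t - w t)) =
      (∫ t in (0 : ℝ)..x, f t * y t) - ∫ t in (0 : ℝ)..x, f t * w t := by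
    simp only [mul_sub]
    exact intervalIntegral.integral_sub ((hf.mul hy).intervalIntegrable _ _)
      ((hf.mul hw).intervalIntegrable _ _)
  rw [volterraKernel, volterraKernel, volterraKernel, h v hv, h u hu]
  module

namespace IsFundamentalPair

variable {V : ℝ → ℝ} {z₀ z p q r s : ℂ} {u v y : ℝ → ℂ}

theorem wronskian_eq_one (h : IsFundamentalPair V z₀ p q r s u v) (x : ℝ) :
    wronskian u v x = 1 := by
  rw [h.left.wronskian_eq h.right, h.det, sub_self, zero_mul, add_zero]

theorem cauchyData_eq (h : IsFundamentalPair V z₀ p q r s u v) (hy : IsSchrodingerIVP V z p q y)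
    (x : ℝ) : cauchyData y x = cauchyData u x + (z - z₀) • volterraKernel u v y x := by
  have huv := h.wronskian_eq_one x
  have huy := h.left.wronskian_eq hy x
  have hvy := h.right.wronskian_eq hy x
  simp only [wronskian] at huv huy hvy
  refine Prod.ext ?_ ?_ <;>
    simp only [cauchyData, volterraKernel, Prod.mk_add_mk, Prod.mk_sub_mk, Prod.smul_mk,
      smul_eq_mul]
  · linear_combination (-y x) * huv + v x * huy - u x * hvy + u x * h.det
  · linear_combination (-deriv y x) * huv + deriv v x * huy - deriv u x * hvy + deriv u x * h.det

end IsFundamentalPair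

theorem norm_integral_zero_le {f : ℝ → ℂ} {B x : ℝ} (hx : 0 ≤ x)
    (hf : ∀ t ∈ Icc 0 x, ‖f t‖ ≤ B) : ‖∫ t in (0 : ℝ)..x, f t‖ ≤ B * x := by
  have h := intervalIntegral.norm_integral_le_of_norm_le_const (a := 0) (b := x) (f := f) (C := B)
    fun t ht => hf t (Ioc_subset_Icc_self (by rwa [uIoc_of_le hx] at ht))
  rwa [sub_zero, abs_of_nonneg hx] at h

/-- On `[0, M]` the function `u` decays at least at rate `lam` and `v` grows at most at that rate,
together with their derivatives. -/
structure HasDichotomy (u v : ℝ → ℂ) (C lam M : ℝ) : Prop where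
  rate_nonneg : 0 ≤ lam
  left : ∀ t ∈ Icc 0 M, ‖cauchyData u t‖ ≤ C * Real.exp (-lam * t)
  right : ∀ t ∈ Icc 0 M, ‖cauchyData v t‖ ≤ C * Real.exp (lam * t)

namespace HasDichotomy

variable {V : ℝ → ℝ} {z₀ z p q r s : ℂ} {u v y : ℝ → ℂ} {C lam M : ℝ}

theorem const_nonneg (h : HasDichotomy u v C lam M) (hM : 0 ≤ M) : 0 ≤ C := by
  simpa using (norm_nonneg _).trans (h.left 0 ⟨le_rfl, hM⟩)

theorem norm_integral_right_mul_le (h : HasDichotomy u v C lam M) {G x : ℝ} (hx : x ∈ Icc 0 M)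
    (hG : 0 ≤ G) (hy : ∀ t ∈ Icc 0 x, ‖y t‖ ≤ G * Real.exp (lam * t)) :
    ‖∫ t in (0 : ℝ)..x, v t * y t‖ ≤ C * G * M * (Real.exp (lam * x) * Real.exp (lam * x)) := by
  have hC := h.const_nonneg (hx.1.trans hx.2)
  have hlam := h.rate_nonneg
  refine (norm_integral_zero_le hx.1
    (B := (C * Real.exp (lam * x)) * (G * Real.exp (lam * x))) fun t ht => ?_).trans ?_
  · refine norm_mul_le_of_le ?_ ((hy t ht).trans (by gcongr; exact ht.2))
    exact (norm_le_norm_cauchyData v t).trans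
      ((h.right t ⟨ht.1, ht.2.trans hx.2⟩).trans (by gcongr; exact ht.2))
  · calc _ ≤ (C * Real.exp (lam * x)) * (G * Real.exp (lam * x)) * M := by gcongr; exact hx.2
      _ = _ := by ring

theorem norm_integral_left_mul_le (h : HasDichotomy u v C lam M) {G x : ℝ} (hx : x ∈ Icc 0 M)
    (hG : 0 ≤ G) (hy : ∀ t ∈ Icc 0 x, ‖y t‖ ≤ G * Real.exp (lam * t)) :
    ‖∫ t in (0 : ℝ)..x, u t * y t‖ ≤ C * G * M := by
  have hC := h.const_nonneg (hx.1.trans hx.2)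
  refine (norm_integral_zero_le hx.1 (B := C * G) fun t ht => ?_).trans (by gcongr; exact hx.2)
  refine (norm_mul_le_of_le ((norm_le_norm_cauchyData u t).trans
    (h.left t ⟨ht.1, ht.2.trans hx.2⟩)) (hy t ht)).trans_eq ?_
  rw [neg_mul, Real.exp_neg]
  field_simp

theorem norm_volterraKernel_le (h : HasDichotomy u v C lam M) {G x : ℝ} (hx : x ∈ Icc 0 M)
    (hG : 0 ≤ G) (hy : ∀ t ∈ Icc 0 x, ‖y t‖ ≤ G * Real.exp (lam * t)) :
    ‖volterraKernel u v y x‖ ≤ 2 * C ^ 2 * M * G * Real.exp (lam * x) := by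
  have hv := h.norm_integral_right_mul_le hx hG hy
  have hu := h.norm_integral_left_mul_le hx hG hy
  calc ‖volterraKernel u v y x‖
      ≤ ‖∫ t in (0 : ℝ)..x, v t * y t‖ * ‖cauchyData u x‖ +
          ‖∫ t in (0 : ℝ)..x, u t * y t‖ * ‖cauchyData v x‖ := by
        rw [← norm_smul, ← norm_smul]
        exact norm_sub_le _ _
    _ ≤ C * G * M * (Real.exp (lam * x) * Real.exp (lam * x)) * (C * Real.exp (-lam * x)) +
          C * G * M * (C * Real.exp (lam * x)) :=
        add_le_add (mul_le_mul hv (h.left x hx) (norm_nonneg _) ((norm_nonneg _).trans hv))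
          (mul_le_mul hu (h.right x hx) (norm_nonneg _) ((norm_nonneg _).trans hu))
    _ = 2 * C ^ 2 * M * G * Real.exp (lam * x) := by
        rw [neg_mul, Real.exp_neg]
        field_simp
        ring

theorem norm_cauchyData_le (h : HasDichotomy u v C lam M)
    (hF : IsFundamentalPair V z₀ p q r s u v) (hy : IsSchrodingerIVP V z p q y)
    (hz : 4 * C ^ 2 * M * ‖z - z₀‖ ≤ 1) {x : ℝ} (hx : x ∈ Icc 0 M) :
    ‖cauchyData y x‖ ≤ 2 * C * Real.exp (lam * x) := by
  have hcont : ContinuousOn (fun x => ‖cauchyData y x‖ / Real.exp (lam * x)) (Icc 0 M) := by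
    have := hy.continuous_cauchyData
    fun_prop (disch := exact fun _ _ => (Real.exp_pos _).ne')
  obtain ⟨x₀, hx₀, hmax⟩ := isCompact_Icc.exists_isMaxOn ⟨x, hx⟩ hcont
  set G := ‖cauchyData y x₀‖ / Real.exp (lam * x₀) with hG
  have hbound : ∀ t ∈ Icc 0 M, ‖cauchyData y t‖ ≤ G * Real.exp (lam * t) := fun t ht =>
    (div_le_iff₀ (Real.exp_pos _)).1 (hmax ht)
  have hker := h.norm_volterraKernel_le hx₀ (G := G) (by positivity) fun t ht =>
    (norm_le_norm_cauchyData y t).trans (hbound t ⟨ht.1, ht.2.trans hx₀.2⟩)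
  have hvolterra : ‖cauchyData y x₀‖ ≤
      C * Real.exp (lam * x₀) + G / 2 * Real.exp (lam * x₀) := by
    rw [hF.cauchyData_eq hy]
    refine norm_add_le_of_le ((h.left x₀ hx₀).trans ?_) ?_
    · have := h.const_nonneg (hx.1.trans hx.2)
      have := h.rate_nonneg
      gcongr
      · exact hx₀.1
      · linarith
    · rw [norm_smul]
      calc _ ≤ ‖z - z₀‖ * (2 * C ^ 2 * M * G * Real.exp (lam * x₀)) := by gcongr
        _ = (4 * C ^ 2 * M * ‖z - z₀‖) * (G / 2 * Real.exp (lam * x₀)) := by ring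
        _ ≤ _ := mul_le_of_le_one_left (by positivity) hz
  have hGle : G ≤ C + G / 2 := by rwa [hG, div_le_iff₀ (Real.exp_pos _), ← hG, add_mul]
  exact (hbound x hx).trans (by gcongr; linarith)

theorem exp_le_norm_cauchyData_right (h : HasDichotomy u v C lam M)
    (hF : IsFundamentalPair V z₀ p q r s u v) (hM : 0 ≤ M) :
    Real.exp (lam * M) ≤ 2 * C * ‖cauchyData v M‖ := by
  have h₁ : 1 ≤ 2 * ‖cauchyData u M‖ * ‖cauchyData v M‖ := by
    simpa [hF.wronskian_eq_one] using norm_wronskian_le u v M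
  have h₂ : 1 ≤ 2 * (C * Real.exp (-lam * M)) * ‖cauchyData v M‖ :=
    h₁.trans (by gcongr; exact h.left M ⟨hM, le_rfl⟩)
  rw [neg_mul, Real.exp_neg] at h₂
  field_simp at h₂
  exact h₂

end HasDichotomy

namespace IsFundamentalPair

variable {V : ℝ → ℝ} {z₀ p q r s : ℂ} {u v : ℝ → ℂ}

theorem exists_hasDichotomy_zero (hF : IsFundamentalPair V z₀ p q r s u v) (M : ℝ) :
    ∃ C, HasDichotomy u v C 0 M := by
  obtain ⟨C₁, h₁⟩ := isCompact_Icc.exists_bound_of_continuousOn (s := Icc 0 M)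
    hF.left.continuous_cauchyData.continuousOn
  obtain ⟨C₂, h₂⟩ := isCompact_Icc.exists_bound_of_continuousOn (s := Icc 0 M)
    hF.right.continuous_cauchyData.continuousOn
  refine ⟨max C₁ C₂, le_rfl, fun t ht => ?_, fun t ht => ?_⟩
  · simpa using .inl (h₁ t ht)
  · simpa using .inr (h₂ t ht)

variable {y : ℂ → ℝ → ℂ}

theorem tendsto_volterraKernel_param (hF : IsFundamentalPair V z₀ p q r s (y z₀) v)
    (hy : ∀ z, IsSchrodingerIVP V z p q (y z)) {x : ℝ} (hx : 0 ≤ x) :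
    Tendsto (fun z => volterraKernel (y z₀) v (y z) x) (𝓝 z₀)
      (𝓝 (volterraKernel (y z₀) v (y z₀) x)) := by
  obtain ⟨C, hD⟩ := hF.exists_hasDichotomy_zero x
  have hC := hD.const_nonneg hx
  have hsmall {K : ℝ} : Tendsto (fun z : ℂ => K * ‖z - z₀‖) (𝓝 z₀) (𝓝 0) := by
    have h : Continuous fun z : ℂ => K * ‖z - z₀‖ := by fun_prop
    simpa using h.tendsto z₀
  rw [tendsto_iff_norm_sub_tendsto_zero]
  refine squeeze_zero' (.of_forall fun _ => norm_nonneg _) ?_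
    (hsmall (K := 2 * C ^ 2 * x * (2 * C ^ 2 * x * (2 * C))))
  filter_upwards [(hsmall (K := 4 * C ^ 2 * x)).eventually_le_const zero_lt_one] with z hz
  have hdiff : ∀ t ∈ Icc 0 x, ‖y z t - y z₀ t‖ ≤ 2 * C ^ 2 * x * (2 * C) * ‖z - z₀‖ := by
    intro t ht
    have hker := hD.norm_volterraKernel_le ht (y := y z) (G := 2 * C) (by positivity)
      fun τ hτ => (norm_le_norm_cauchyData _ τ).trans
        (hD.norm_cauchyData_le hF (hy z) hz ⟨hτ.1, hτ.2.trans ht.2⟩)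
    have heq := congrArg Prod.fst (hF.cauchyData_eq (hy z) t)
    rw [Prod.fst_add, Prod.smul_fst] at heq
    simp only [cauchyData] at heq
    rw [heq, add_sub_cancel_left, norm_smul, mul_comm]
    gcongr
    simpa using (norm_fst_le _).trans hker
  rw [← volterraKernel_sub (hy z₀).continuous hF.right.continuous (hy z).continuous
    (hy z₀).continuous]
  refine (hD.norm_volterraKernel_le ⟨hx, le_rfl⟩ (G := 2 * C ^ 2 * x * (2 * C) * ‖z - z₀‖)
    (by positivity) (fun t ht => by simpa using hdiff t ht)).trans_eq ?_
  simp only [zero_mul, Real.exp_zero]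
  ring

/-- By the Volterra equation the difference quotient is the kernel evaluated at `y z`, so
differentiability at `z₀` amounts to continuity of the kernel there. -/
theorem hasDerivAt_cauchyData_param (hF : IsFundamentalPair V z₀ p q r s (y z₀) v)
    (hy : ∀ z, IsSchrodingerIVP V z p q (y z)) {x : ℝ} (hx : 0 ≤ x) :
    HasDerivAt (fun z => cauchyData (y z) x) (volterraKernel (y z₀) v (y z₀) x) z₀ := by
  rw [hasDerivAt_iff_tendsto_slope]
  refine ((hF.tendsto_volterraKernel_param hy hx).mono_left nhdsWithin_le_nhds).congr' ?_
  filter_upwards [self_mem_nhdsWithin] with z hz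
  rw [slope_def_module, hF.cauchyData_eq (hy z), add_sub_cancel_left,
    inv_smul_smul₀ (sub_ne_zero.2 hz)]

end IsFundamentalPair

end SchrodingerODE

section SquareIntegrableDecay

open Set Filter Topology MeasureTheory

theorem sq_integral_le_integral_sq {f : ℝ → ℝ} (hf : Continuous f) (x : ℝ) :
    (∫ t in x..x + 1, f t) ^ 2 ≤ ∫ t in x..x + 1, f t ^ 2 := by
  have : IsProbabilityMeasure (volume.restrict (Ioc x (x + 1))) := ⟨by simp⟩
  have hint {g : ℝ → ℝ} (hg : Continuous g) : Integrable g (volume.restrict (Ioc x (x + 1))) :=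
    (hg.intervalIntegrable x (x + 1)).1
  rw [intervalIntegral.integral_of_le (by linarith), intervalIntegral.integral_of_le (by linarith)]
  exact even_two.convexOn_pow.map_integral_le (continuous_pow 2).continuousOn isClosed_univ
    (by simp) (hint hf) (hint (hf.pow 2))

theorem tendsto_integral_norm_zero_of_memLp {y : ℝ → ℂ} (hy : Continuous y)
    (hL : MemLp y 2 volume) : Tendsto (fun x : ℝ => ∫ t in x..x + 1, ‖y t‖) atTop (𝓝 0) := by
  have hint : Integrable (fun t => ‖y t‖ ^ 2) := (memLp_two_iff_integrable_sq_norm hL.1).1 hL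
  have hprim := intervalIntegral_tendsto_integral_Ioi 0 hint.integrableOn tendsto_id
  have hdiff := (hprim.comp (tendsto_atTop_add_const_right atTop (1 : ℝ) tendsto_id)).sub hprim
  have hsq : Tendsto (fun x : ℝ => ∫ t in x..x + 1, ‖y t‖ ^ 2) atTop (𝓝 0) := by
    rw [sub_self] at hdiff
    exact hdiff.congr fun x => intervalIntegral.integral_interval_sub_left
      hint.intervalIntegrable hint.intervalIntegrable
  refine squeeze_zero (fun x => intervalIntegral.integral_nonneg (by linarith)
    fun t _ => norm_nonneg _) (fun x => ?_) (by simpa using hsq.sqrt)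
  exact Real.le_sqrt_of_sq_le (sq_integral_le_integral_sq hy.norm x)

namespace IsSchrodingerIVP

variable {V : ℝ → ℝ} {z a b : ℂ} {y : ℝ → ℂ}

/-- Test the equation on `[x, x + 1]` against `(x + 1 - t) ^ (n + 2)`, which vanishes to second
order at the right end point. -/
theorem deriv_add_mul_eq_integral (hV : Continuous V) (hy : IsSchrodingerIVP V z a b y) (n : ℕ)
    (x : ℝ) : deriv y x + (n + 2) * y x = ∫ t in x..x + 1,
      ((n + 2) * (n + 1) * (x + 1 - t : ℂ) ^ n - (x + 1 - t : ℂ) ^ (n + 2) * (V t - z)) * y t := by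
  have hd (t : ℝ) : HasDerivAt (fun t : ℝ => -((x + 1 - t : ℂ) ^ (n + 2) * deriv y t +
      (n + 2) * (x + 1 - t : ℂ) ^ (n + 1) * y t)) (((n + 2) * (n + 1) * (x + 1 - t : ℂ) ^ n -
      (x + 1 - t : ℂ) ^ (n + 2) * (V t - z)) * y t) t := by
    have hs : HasDerivAt (fun t : ℝ => (x + 1 - t : ℂ)) (-1) t :=
      (Complex.ofRealCLM.hasDerivAt (x := t)).const_sub _
    refine (((hs.pow (n + 2)).mul (hy.hasDerivAt_deriv t)).add
      (((hs.pow (n + 1)).const_mul (n + 2 : ℂ)).mul (hy.hasDerivAt t))).neg.congr_deriv ?_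
    simp only [Pi.pow_apply, Nat.add_one_sub_one, show n + 2 - 1 = n + 1 from rfl]
    push_cast
    ring
  have hcont : Continuous fun t : ℝ => ((n + 2) * (n + 1) * (x + 1 - t : ℂ) ^ n -
      (x + 1 - t : ℂ) ^ (n + 2) * (V t - z)) * y t := by
    have := hy.continuous
    fun_prop
  rw [intervalIntegral.integral_eq_sub_of_hasDerivAt (fun t _ => hd t)
    (hcont.intervalIntegrable _ _)]
  push_cast
  ring

theorem norm_deriv_add_mul_le (hV : Continuous V) (hy : IsSchrodingerIVP V z a b y) (n : ℕ) {x : ℝ}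
    {K : ℝ} (hK : ∀ t, x ≤ t → ‖(V t : ℂ) - z‖ ≤ K) :
    ‖deriv y x + (n + 2) * y x‖ ≤ ((n + 2) * (n + 1) + K) * ∫ t in x..x + 1, ‖y t‖ := by
  have hyc := hy.continuous
  rw [hy.deriv_add_mul_eq_integral hV n x, ← intervalIntegral.integral_const_mul]
  refine intervalIntegral.norm_integral_le_of_norm_le (by linarith)
    (ae_of_all _ fun t ht => ?_) (Continuous.intervalIntegrable (by fun_prop) _ _)
  have hle (m : ℕ) : ‖(x + 1 - t : ℂ) ^ m‖ ≤ 1 := by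
    have hcast : (x + 1 - t : ℂ) = ((x + 1 - t : ℝ) : ℂ) := by push_cast; rfl
    rw [norm_pow, hcast, Complex.norm_real, Real.norm_of_nonneg (by linarith [ht.2])]
    exact pow_le_one₀ (by linarith [ht.2]) (by linarith [ht.1])
  have hcoeff : ‖((n + 2) * (n + 1) : ℂ)‖ = (n + 2) * (n + 1) := by
    exact_mod_cast Complex.norm_natCast ((n + 2) * (n + 1))
  rw [norm_mul]
  gcongr
  refine norm_sub_le_of_le ?_ ?_
  · rw [norm_mul, hcoeff]
    exact mul_le_of_le_one_right (by positivity) (hle n)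
  · exact (norm_mul_le_of_le (hle _) (hK t ht.1.le)).trans_eq (one_mul K)

theorem tendsto_cauchyData_zero_of_memLp (hV : Continuous V) (hy : IsSchrodingerIVP V z a b y)
    {K : ℝ} (hK : ∀ t, 0 ≤ t → ‖(V t : ℂ) - z‖ ≤ K) (hL : MemLp y 2 volume) :
    Tendsto (cauchyData y) atTop (𝓝 0) := by
  have hlim (n : ℕ) : Tendsto (fun x => deriv y x + (n + 2) * y x) atTop (𝓝 0) := by
    have hint := (tendsto_integral_norm_zero_of_memLp hy.continuous hL).const_mul
      ((n + 2) * (n + 1) + K)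
    rw [mul_zero] at hint
    refine squeeze_zero_norm' ?_ hint
    filter_upwards [eventually_ge_atTop 0] with x hx
    exact hy.norm_deriv_add_mul_le hV n fun t ht => hK t (hx.trans ht)
  have h₀ : Tendsto y atTop (𝓝 0) := by
    refine (sub_zero (0 : ℂ) ▸ (hlim 1).sub (hlim 0)).congr fun x => ?_
    push_cast
    ring
  have h₁ : Tendsto (deriv y) atTop (𝓝 0) := by
    have h := (hlim 0).sub (h₀.const_mul 2)
    rw [mul_zero, sub_zero] at h
    refine h.congr fun x => ?_
    push_cast
    ring
  exact h₀.prodMk_nhds h₁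

end IsSchrodingerIVP

end SquareIntegrableDecay

section Floquet

open Set Filter Topology MeasureTheory

theorem IsDefectPotential.eventually_periodic {V : ℝ → ℝ} {ρ : ℝ} (hV : IsDefectPotential V ρ)
    {x : ℝ} (hx : ρ < x) : V (x + 1) = V x := by
  obtain ⟨Vper, Vdef, hsum, hper, hdef⟩ := hV.decomposition
  have hdef_right {t : ℝ} (ht : ρ < t) : Vdef t = 0 := hdef t (ht.trans_le (le_abs_self t))
  rw [hsum, hsum, hper, hdef_right hx, hdef_right (hx.trans (lt_add_one x))]

theorem exists_upper_bound_of_eventually_periodic {h : ℝ → ℝ} (hc : Continuous h) {R T : ℝ}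
    (hT : 0 < T) (hper : ∀ x, R < x → h (x + T) = h x) : ∃ C, ∀ x, 0 ≤ x → h x ≤ C := by
  obtain ⟨C, hC⟩ := isCompact_Icc.bddAbove_image (K := Icc (-T) (|R| + T)) hc.continuousOn
  have hstep (n : ℕ) : ∀ x, 0 ≤ x → x ≤ |R| + T + n * T → h x ≤ C := by
    induction n with
    | zero =>
      exact fun x hx hx' => hC (mem_image_of_mem h ⟨by linarith, by simpa using hx'⟩)
    | succ n ih =>
      intro x hx hx'
      push_cast at hx'
      rcases le_or_gt x (|R| + T) with hle | hlt
      · exact hC (mem_image_of_mem h ⟨by linarith, hle⟩)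
      · have hprev := hper (x - T) (by linarith [le_abs_self R])
        rw [sub_add_cancel] at hprev
        rw [hprev]
        exact ih _ (by linarith [abs_nonneg R]) (by linarith)
  refine ⟨C, fun x hx => ?_⟩
  obtain ⟨n, hn⟩ := exists_nat_ge (x / T)
  exact hstep n x hx (by linarith [(div_le_iff₀ hT).1 hn, abs_nonneg R])

theorem exists_exp_bound_of_multiplier {F : Type*} [NormedAddCommGroup F] [NormedSpace ℂ F]
    {f : ℝ → F} (hf : Continuous f) {R T l : ℝ} (hT : 0 < T) {q : ℂ}
    (hq : ‖q‖ = Real.exp (l * T)) (hper : ∀ x, R < x → f (x + T) = q • f x) :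
    ∃ C, ∀ x, 0 ≤ x → ‖f x‖ ≤ C * Real.exp (l * x) := by
  obtain ⟨C, hC⟩ := exists_upper_bound_of_eventually_periodic
    (h := fun x => ‖f x‖ / Real.exp (l * x))
    (hf.norm.div (by fun_prop) fun _ => (Real.exp_pos _).ne') hT (R := R) fun x hx => by
      rw [hper x hx, norm_smul, hq, mul_add, Real.exp_add]
      field_simp
  exact ⟨C, fun x hx => (div_le_iff₀ (Real.exp_pos _)).1 (hC x hx)⟩

@[simp]
theorem cauchyData_comp_add_const (y : ℝ → ℂ) (T x : ℝ) :
    cauchyData (fun t => y (t + T)) x = cauchyData y (x + T) := by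
  rw [cauchyData, cauchyData, deriv_comp_add_const]

/-- `y` solves `-y'' + V y = z y` classically on the half line `(R, ∞)`. -/
structure IsSolutionBeyond (V : ℝ → ℝ) (z : ℂ) (R : ℝ) (y : ℝ → ℂ) : Prop where
  hasDerivAt : ∀ x, R < x → HasDerivAt y (deriv y x) x
  hasDerivAt_deriv : ∀ x, R < x → HasDerivAt (deriv y) (((V x : ℂ) - z) * y x) x

theorem IsSchrodingerIVP.isSolutionBeyond {V : ℝ → ℝ} {z a b : ℂ} {y : ℝ → ℂ}
    (hy : IsSchrodingerIVP V z a b y) (R : ℝ) : IsSolutionBeyond V z R y :=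
  ⟨fun x _ => hy.hasDerivAt x, fun x _ => hy.hasDerivAt_deriv x⟩

theorem IsSchrodingerIVP.isSolutionBeyond_shift {V : ℝ → ℝ} {z a b : ℂ} {y : ℝ → ℂ} {R T : ℝ}
    (hy : IsSchrodingerIVP V z a b y) (hper : ∀ x, R < x → V (x + T) = V x) :
    IsSolutionBeyond V z R (fun x => y (x + T)) := by
  have hderiv : deriv (fun x => y (x + T)) = fun x => deriv y (x + T) :=
    funext fun x => deriv_comp_add_const ..
  constructor <;> intro x hx <;> rw [hderiv]
  · exact (hy.hasDerivAt (x + T)).comp_add_const x T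
  · exact hper x hx ▸ (hy.hasDerivAt_deriv (x + T)).comp_add_const x T

theorem IsSolutionBeyond.exists_wronskian_eq {V : ℝ → ℝ} {z : ℂ} {R : ℝ} {y w : ℝ → ℂ}
    (hy : IsSolutionBeyond V z R y) (hw : IsSolutionBeyond V z R w) :
    ∃ c, ∀ x, R < x → wronskian y w x = c := by
  have hd (x : ℝ) (hx : x ∈ Ioi R) : HasDerivAt (wronskian y w) 0 x :=
    (((hy.hasDerivAt x hx).mul (hw.hasDerivAt_deriv x hx)).sub
      ((hy.hasDerivAt_deriv x hx).mul (hw.hasDerivAt x hx))).congr_deriv (by ring)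
  exact isOpen_Ioi.exists_is_const_of_deriv_eq_zero isPreconnected_Ioi
    (fun x hx => (hd x hx).differentiableAt.differentiableWithinAt) fun x hx => (hd x hx).deriv

theorem tendsto_wronskian_zero {y w : ℝ → ℂ} (hy : Tendsto (cauchyData y) atTop (𝓝 0))
    (hw : Tendsto (cauchyData w) atTop (𝓝 0)) : Tendsto (wronskian y w) atTop (𝓝 0) :=
  squeeze_zero_norm (norm_wronskian_le y w)
    (by simpa using (hy.norm.const_mul 2).mul hw.norm)

namespace IsFundamentalPair

variable {V : ℝ → ℝ} {z p q r s : ℂ} {u v y : ℝ → ℂ} {R T : ℝ}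

theorem cauchyData_eq_wronskian_smul_add (hF : IsFundamentalPair V z p q r s u v) (y : ℝ → ℂ)
    (x : ℝ) : cauchyData y x =
      wronskian y v x • cauchyData u x + wronskian u y x • cauchyData v x := by
  have h := hF.wronskian_eq_one x
  simp only [wronskian] at h
  refine Prod.ext ?_ ?_ <;>
    simp only [cauchyData, wronskian, Prod.mk_add_mk, Prod.smul_mk, smul_eq_mul]
  · linear_combination (-y x) * h
  · linear_combination (-deriv y x) * h

theorem exists_cauchyData_eq_smul_add (hF : IsFundamentalPair V z p q r s u v)
    (hy : IsSolutionBeyond V z R y) :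
    ∃ α β : ℂ, ∀ x, R < x → cauchyData y x = α • cauchyData u x + β • cauchyData v x := by
  obtain ⟨α, hα⟩ := hy.exists_wronskian_eq (hF.right.isSolutionBeyond R)
  obtain ⟨β, hβ⟩ := (hF.left.isSolutionBeyond R).exists_wronskian_eq hy
  exact ⟨α, β, fun x hx => by rw [hF.cauchyData_eq_wronskian_smul_add y, hα x hx, hβ x hx]⟩

theorem exists_cauchyData_eq_smul (hF : IsFundamentalPair V z p q r s u v)
    (hu : Tendsto (cauchyData u) atTop (𝓝 0)) (hy : IsSolutionBeyond V z R y)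
    (hy₀ : Tendsto (cauchyData y) atTop (𝓝 0)) :
    ∃ α : ℂ, ∀ x, R < x → cauchyData y x = α • cauchyData u x := by
  obtain ⟨α, hα⟩ := hy.exists_wronskian_eq (hF.right.isSolutionBeyond R)
  obtain ⟨β, hβ⟩ := (hF.left.isSolutionBeyond R).exists_wronskian_eq hy
  have hβ₀ : β = 0 := tendsto_nhds_unique
    (tendsto_const_nhds.congr' ((eventually_gt_atTop R).mono fun x hx => (hβ x hx).symm))
    (tendsto_wronskian_zero hu hy₀)
  exact ⟨α, fun x hx => by
    rw [hF.cauchyData_eq_wronskian_smul_add y, hα x hx, hβ x hx, hβ₀, zero_smul, add_zero]⟩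

theorem cauchyData_left_ne_zero (hF : IsFundamentalPair V z p q r s u v) (x : ℝ) :
    cauchyData u x ≠ 0 := fun h => by
  have hW := norm_wronskian_le u v x
  rw [h, hF.wronskian_eq_one, norm_one, norm_zero, mul_zero, zero_mul] at hW
  exact hW.not_gt one_pos

theorem exists_multiplier_left (hF : IsFundamentalPair V z p q r s u v) (hT : 0 < T)
    (hper : ∀ x, R < x → V (x + T) = V x) (hu : Tendsto (cauchyData u) atTop (𝓝 0)) :
    ∃ μ : ℂ, μ ≠ 0 ∧ ‖μ‖ < 1 ∧ ∀ x, R < x → cauchyData u (x + T) = μ • cauchyData u x := by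
  have hshift : Tendsto (fun x => x + T) atTop atTop :=
    tendsto_atTop_add_const_right _ _ tendsto_id
  obtain ⟨μ, hμ⟩ := hF.exists_cauchyData_eq_smul hu (hF.left.isSolutionBeyond_shift hper)
    ((hu.comp hshift).congr fun x => (cauchyData_comp_add_const u T x).symm)
  simp only [cauchyData_comp_add_const] at hμ
  refine ⟨μ, ?_, ?_, hμ⟩
  · rintro rfl
    exact hF.cauchyData_left_ne_zero _ ((hμ (R + 1) (lt_add_one R)).trans (zero_smul ..))
  · have hpow (n : ℕ) : cauchyData u (R + 1 + n * T) = μ ^ n • cauchyData u (R + 1) := by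
      induction n with
      | zero => simp
      | succ n ih =>
        rw [pow_succ', mul_smul, ← ih, ← hμ _ (by linarith [show 0 ≤ n * T by positivity])]
        congr 1
        push_cast
        ring
    have hlim : Tendsto (fun n : ℕ => R + 1 + n * T) atTop atTop :=
      tendsto_atTop_add_const_left _ _ (tendsto_natCast_atTop_atTop.atTop_mul_const hT)
    have hnorm := (hu.comp hlim).norm
    simp only [Function.comp_def, hpow, norm_smul, norm_pow, norm_zero] at hnorm
    have hne := norm_ne_zero_iff.2 (hF.cauchyData_left_ne_zero (R + 1))
    have := hnorm.div_const ‖cauchyData u (R + 1)‖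
    simp only [mul_div_cancel_right₀ _ hne, zero_div] at this
    simpa using tendsto_pow_atTop_nhds_zero_iff.1 this

theorem exists_multiplier_right (hF : IsFundamentalPair V z p q r s u v)
    (hper : ∀ x, R < x → V (x + T) = V x) {μ : ℂ} (hμ₁ : ‖μ‖ < 1)
    (hμ : ∀ x, R < x → cauchyData u (x + T) = μ • cauchyData u x) :
    ∃ d : ℂ, ∀ x, R < x → cauchyData v (x + T) + d • cauchyData u (x + T) =
      μ⁻¹ • (cauchyData v x + d • cauchyData u x) := by
  obtain ⟨ν, β, hv⟩ := hF.exists_cauchyData_eq_smul_add (hF.right.isSolutionBeyond_shift hper)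
  simp only [cauchyData_comp_add_const] at hv
  have hμβ : μ * β = 1 := by
    have hx := lt_add_one R
    have hW := hF.wronskian_eq_one (R + 1)
    have hWT := hF.wronskian_eq_one (R + 1 + T)
    obtain ⟨hu₀, hu₁⟩ := Prod.ext_iff.1 (hμ _ hx)
    obtain ⟨hv₀, hv₁⟩ := Prod.ext_iff.1 (hv _ hx)
    simp only [cauchyData, Prod.fst_add, Prod.snd_add, Prod.smul_mk, smul_eq_mul] at hu₀ hu₁ hv₀ hv₁
    rw [wronskian, hu₀, hu₁, hv₀, hv₁] at hWT
    rw [wronskian] at hW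
    linear_combination hWT - μ * β * hW
  have hβ : β = μ⁻¹ := eq_inv_of_mul_eq_one_right hμβ
  have hβμ : β - μ ≠ 0 := fun h => by
    have hsq : ‖μ‖ * ‖μ‖ = 1 := by rw [← norm_mul, ← norm_one (α := ℂ), ← hμβ, sub_eq_zero.1 h]
    nlinarith [norm_nonneg μ]
  refine ⟨ν / (β - μ), fun x hx => ?_⟩
  have hd : ν + ν / (β - μ) * μ = β * (ν / (β - μ)) := by
    field_simp
    ring
  rw [hv x hx, hμ x hx, ← hβ, smul_add, smul_smul, smul_smul, ← hd]
  module

/-- Along the period the decaying solution has a multiplier `μ` with `0 < |μ| < 1`; a suitable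
second solution then has the multiplier `μ⁻¹`, and the rate is `-log |μ| / T`. -/
theorem exists_hasDichotomy (hF : IsFundamentalPair V z p q r s u v) (hV : Continuous V)
    (hT : 0 < T) (hper : ∀ x, R < x → V (x + T) = V x) (hL : MemLp u 2 volume) :
    ∃ lam C : ℝ, 0 < lam ∧ ∀ M, HasDichotomy u v C lam M := by
  obtain ⟨K, hK⟩ := exists_upper_bound_of_eventually_periodic (h := fun t => ‖(V t : ℂ) - z‖)
    (by fun_prop) hT fun x hx => by rw [hper x hx]
  have hu := hF.left.tendsto_cauchyData_zero_of_memLp hV hK hL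
  obtain ⟨μ, hμ₀, hμ₁, hμ⟩ := hF.exists_multiplier_left hT hper hu
  obtain ⟨d, hd⟩ := hF.exists_multiplier_right hper hμ₁ hμ
  obtain ⟨lam, hlam⟩ : ∃ lam, lam = -Real.log ‖μ‖ / T := ⟨_, rfl⟩
  have hlam₀ : 0 < lam :=
    hlam ▸ div_pos (neg_pos.2 (Real.log_neg (norm_pos_iff.2 hμ₀) hμ₁)) hT
  have hnorm : ‖μ‖ = Real.exp (-lam * T) := by
    rw [hlam, neg_div, neg_neg, div_mul_cancel₀ _ hT.ne', Real.exp_log (norm_pos_iff.2 hμ₀)]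
  have hnorm_inv : ‖μ⁻¹‖ = Real.exp (lam * T) := by
    rw [norm_inv, hnorm, ← Real.exp_neg, neg_mul, neg_neg]
  have hcu := hF.left.continuous_cauchyData
  have hcv := hF.right.continuous_cauchyData
  obtain ⟨A, hA⟩ := exists_exp_bound_of_multiplier hcu hT hnorm hμ
  obtain ⟨B, hB⟩ := exists_exp_bound_of_multiplier (hcv.add (hcu.const_smul d)) hT hnorm_inv hd
  have hA₀ : 0 ≤ A := by simpa using (norm_nonneg _).trans (hA 0 le_rfl)
  refine ⟨lam, max A (B + ‖d‖ * A), hlam₀, fun M => ⟨hlam₀.le, fun t ht => ?_, fun t ht => ?_⟩⟩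
  · exact (hA t ht.1).trans (by gcongr; exact le_max_left _ _)
  · have hle : -lam * t ≤ lam * t := by nlinarith [mul_nonneg hlam₀.le ht.1]
    calc ‖cauchyData v t‖
        = ‖(cauchyData v t + d • cauchyData u t) - d • cauchyData u t‖ := by
          rw [add_sub_cancel_right]
      _ ≤ B * Real.exp (lam * t) + ‖d‖ * (A * Real.exp (lam * t)) := by
          refine norm_sub_le_of_le (hB t ht.1) ?_
          rw [norm_smul]
          gcongr
          exact (hA t ht.1).trans (by gcongr)
      _ ≤ max A (B + ‖d‖ * A) * Real.exp (lam * t) := by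
          rw [← mul_assoc, ← add_mul]
          gcongr
          exact le_max_right _ _

end IsFundamentalPair

end Floquet

section Newton

open Set Filter Topology Metric

theorem norm_deriv_sub_deriv_center_le {F : Type*} [NormedAddCommGroup F] [NormedSpace ℂ F]
    [CompleteSpace F] {f : ℂ → F} {c z : ℂ} {R B : ℝ} (hR : 0 < R)
    (hf : DifferentiableOn ℂ f (ball c R)) (hB : ∀ w ∈ ball c R, ‖f w‖ ≤ B)
    (hz : z ∈ closedBall c (R / 2)) :
    ‖deriv f z - deriv f c‖ ≤ 32 * B / R ^ 2 * ‖z - c‖ := by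
  have hsub : ∀ w ∈ closedBall c (R / 2), closedBall w (R / 4) ⊆ ball c R := fun w hw =>
    closedBall_subset_ball' (by linarith [mem_closedBall.1 hw])
  have hsecond : ∀ w ∈ closedBall c (R / 2), ‖deriv (deriv f) w‖ ≤ 32 * B / R ^ 2 := by
    intro w hw
    have h := Complex.norm_iteratedDeriv_le_of_forall_mem_sphere_norm_le (n := 2) (c := w)
      (R := R / 4) (C := B) (by positivity)
      (hf.mono (closure_ball_subset_closedBall.trans (hsub w hw))).diffContOnCl
      fun x hx => hB x (hsub w hw (sphere_subset_closedBall hx))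
    rw [iteratedDeriv_succ, iteratedDeriv_one] at h
    refine h.trans_eq ?_
    rw [Nat.factorial_two]
    push_cast
    ring
  have hf' : ∀ w ∈ closedBall c (R / 2), DifferentiableAt ℂ (deriv f) w := fun w hw =>
    (hf.deriv isOpen_ball).differentiableAt
      (isOpen_ball.mem_nhds (closedBall_subset_ball (by linarith) hw))
  exact (convex_closedBall c (R / 2)).norm_image_sub_le_of_norm_deriv_le hf' hsecond
    (mem_closedBall_self (by positivity)) hz

theorem norm_sub_sub_deriv_center_le {F : Type*} [NormedAddCommGroup F] [NormedSpace ℂ F]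
    [CompleteSpace F] {f : ℂ → F} {c z w : ℂ} {R B r : ℝ} (hR : 0 < R)
    (hf : DifferentiableOn ℂ f (ball c R)) (hB : ∀ w ∈ ball c R, ‖f w‖ ≤ B) (hr : r ≤ R / 2)
    (hz : z ∈ closedBall c r) (hw : w ∈ closedBall c r) :
    ‖f z - f w - (z - w) • deriv f c‖ ≤ 32 * B / R ^ 2 * r * ‖z - w‖ := by
  have hB₀ : 0 ≤ B := (norm_nonneg _).trans (hB c (mem_ball_self hR))
  have hderiv : ∀ x ∈ closedBall c r,
      HasDerivWithinAt (fun x => f x - x • deriv f c) (deriv f x - deriv f c) (closedBall c r) x :=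
    fun x hx => by
      have hx' : x ∈ ball c R := closedBall_subset_ball (by linarith) hx
      have hfx := (hf.differentiableAt (isOpen_ball.mem_nhds hx')).hasDerivAt
      exact ((hfx.sub ((hasDerivAt_id x).smul_const (deriv f c))).congr_deriv
        (by rw [one_smul])).hasDerivWithinAt
  have hbound : ∀ x ∈ closedBall c r, ‖deriv f x - deriv f c‖ ≤ 32 * B / R ^ 2 * r :=
    fun x hx => (norm_deriv_sub_deriv_center_le hR hf hB (closedBall_subset_closedBall hr hx)).trans
      (by gcongr; exact mem_closedBall_iff_norm.1 hx)
  have h := (convex_closedBall c r).norm_image_sub_le_of_norm_hasDerivWithin_le hderiv hbound hw hz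
  rwa [sub_sub_sub_comm, ← sub_smul] at h

theorem existsUnique_root_of_norm_sub_sub_mul_le {𝕜 : Type*} [NormedField 𝕜] [CompleteSpace 𝕜]
    {f : 𝕜 → 𝕜} {c d : 𝕜} {r : ℝ} (hd : d ≠ 0) (hr : 0 ≤ r) (hfc : 2 * ‖f c‖ ≤ ‖d‖ * r)
    (hf : ∀ z ∈ closedBall c r, ∀ w ∈ closedBall c r,
      2 * ‖f z - f w - (z - w) * d‖ ≤ ‖d‖ * ‖z - w‖) :
    ∃! w, w ∈ closedBall c r ∧ f w = 0 := by
  have hd' : 0 < ‖d‖ := norm_pos_iff.2 hd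
  let N : 𝕜 → 𝕜 := fun z => z - f z / d
  have hlip : ∀ z ∈ closedBall c r, ∀ w ∈ closedBall c r, ‖N z - N w‖ ≤ 1 / 2 * ‖z - w‖ := by
    intro z hz w hw
    have h : N z - N w = -((f z - f w - (z - w) * d) / d) := by
      simp only [N]
      field_simp
      ring
    rw [h, norm_neg, norm_div, div_le_iff₀ hd']
    linarith [hf z hz w hw]
  have hmaps : MapsTo N (closedBall c r) (closedBall c r) := by
    intro z hz
    rw [mem_closedBall_iff_norm] at hz ⊢
    have hz' := hlip z (mem_closedBall_iff_norm.2 hz) c (mem_closedBall_self hr)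
    have hc : ‖N c - c‖ ≤ r / 2 := by
      rw [sub_sub_cancel_left, norm_neg, norm_div, div_le_iff₀ hd']
      linarith
    linarith [norm_sub_le_norm_sub_add_norm_sub (N z) (N c) c]
  have hcontr : ContractingWith (1 / 2) (hmaps.restrict N _ _) :=
    ⟨by norm_num, LipschitzWith.of_dist_le_mul fun z w => by
      simpa [Subtype.dist_eq, dist_eq_norm] using hlip z z.2 w w.2⟩
  obtain ⟨w, hw, hfix, -⟩ := hcontr.exists_fixedPoint' isClosed_closedBall.isComplete hmaps
    (mem_closedBall_self hr) (edist_ne_top _ _)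
  have hroot : f w = 0 := by
    have h : w - f w / d = w := hfix
    simpa [hd] using h
  refine ⟨w, ⟨hw, hroot⟩, fun z ⟨hz, hfz⟩ => ?_⟩
  have h := hlip z hz w hw
  simp only [N, hfz, hroot, zero_div, sub_zero] at h
  exact sub_eq_zero.1 (norm_le_zero_iff.1 (by linarith))

theorem norm_root_sub_newton_step_le {𝕜 : Type*} [NormedField 𝕜] {f : 𝕜 → 𝕜} {c d w : 𝕜} {L : ℝ}
    (hd : d ≠ 0) (hL : 0 ≤ L) (hw : f w = 0) (hLw : 2 * (L * ‖w - c‖) ≤ ‖d‖)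
    (hf : ‖f w - f c - (w - c) * d‖ ≤ L * ‖w - c‖ * ‖w - c‖) :
    ‖w - (c - f c / d)‖ ≤ 4 * L * ‖f c‖ ^ 2 / ‖d‖ ^ 3 := by
  have hd' : 0 < ‖d‖ := norm_pos_iff.2 hd
  have hdist : ‖w - c‖ ≤ 2 * ‖f c‖ / ‖d‖ := by
    have h : ‖w - c‖ * ‖d‖ ≤ L * ‖w - c‖ * ‖w - c‖ + ‖f c‖ := by
      calc ‖w - c‖ * ‖d‖ = ‖(f w - f c - (w - c) * d) + f c‖ := by
            rw [hw, ← norm_mul, ← norm_neg]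
            congr 1
            ring
        _ ≤ _ := norm_add_le_of_le hf le_rfl
    rw [le_div_iff₀ hd']
    nlinarith [norm_nonneg (w - c)]
  have hstep : w - (c - f c / d) = -((f w - f c - (w - c) * d) / d) := by
    rw [hw]
    field_simp
    ring
  rw [hstep, norm_neg, norm_div, div_le_iff₀ hd']
  calc _ ≤ L * ‖w - c‖ * ‖w - c‖ := hf
    _ ≤ L * (2 * ‖f c‖ / ‖d‖) * (2 * ‖f c‖ / ‖d‖) := by gcongr
    _ = _ := by
      field_simp
      ring

theorem existsUnique_root_near_newton_step {f : ℂ → ℂ} {c : ℂ} {R B r : ℝ} (hR : 0 < R)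
    (hf : DifferentiableOn ℂ f (ball c R)) (hB : ∀ w ∈ ball c R, ‖f w‖ ≤ B) (hr : 0 ≤ r)
    (hrR : r ≤ R / 2) (hd : deriv f c ≠ 0) (hfc : 2 * ‖f c‖ ≤ ‖deriv f c‖ * r)
    (hBr : 2 * (32 * B / R ^ 2 * r) ≤ ‖deriv f c‖) :
    (∃! w, ‖w - c‖ ≤ r ∧ f w = 0) ∧ ∀ w, ‖w - c‖ ≤ r → f w = 0 →
      ‖w - (c - f c / deriv f c)‖ ≤ 4 * (32 * B / R ^ 2) * ‖f c‖ ^ 2 / ‖deriv f c‖ ^ 3 := by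
  have hB₀ : 0 ≤ B := (norm_nonneg _).trans (hB c (mem_ball_self hR))
  constructor
  · simp only [← mem_closedBall_iff_norm]
    refine existsUnique_root_of_norm_sub_sub_mul_le hd hr hfc fun z hz w hw => ?_
    have h := norm_sub_sub_deriv_center_le hR hf hB hrR hz hw
    rw [smul_eq_mul] at h
    nlinarith [norm_nonneg (z - w)]
  · intro w hw hfw
    refine norm_root_sub_newton_step_le hd (by positivity) hfw (le_trans (by gcongr) hBr) ?_
    simpa using norm_sub_sub_deriv_center_le hR hf hB (hw.trans hrR)
      (mem_closedBall_iff_norm.2 le_rfl) (mem_closedBall_self (norm_nonneg (w - c)))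

/-- With `X = exp (k M)` these are the scales of the problem: a value `X⁻²` and a derivative `X²` at
the centre, and the bound `X²` on a ball of radius `1 / M`. -/
theorem existsUnique_root_of_scale {f : ℂ → ℂ} {c : ℂ} {η A a B M X : ℝ} (hη : 0 < η) (ha : 0 < a)
    (hM : 1 ≤ M) (hX : 1 ≤ X) (hηX : 2 ≤ X * η) (hBX : 64 * B ≤ X * (a * η ^ 2))
    (hAX : 2 * A * M ^ 2 ≤ X * a) (hMX : M ^ 2 ≤ X) (hf : DifferentiableOn ℂ f (ball c (η / M)))
    (hB : ∀ w ∈ ball c (η / M), ‖f w‖ ≤ B * X ^ 2) (hfc : ‖f c‖ ≤ A * (X ^ 2)⁻¹)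
    (hd : a * X ^ 2 ≤ ‖deriv f c‖) :
    (∃! w, ‖w - c‖ ≤ 1 / M ^ 2 * X⁻¹ ∧ f w = 0) ∧ ∀ w, ‖w - c‖ ≤ 1 / M ^ 2 * X⁻¹ → f w = 0 →
      ‖w - (c - f c / deriv f c)‖ ≤ 128 * B * A ^ 2 / (η ^ 2 * a ^ 3) * (X ^ 4)⁻¹ := by
  have hB₀ : 0 ≤ B := by
    have h := (norm_nonneg _).trans (hB c (mem_ball_self (by positivity)))
    exact nonneg_of_mul_nonneg_left h (by positivity)
  have hrR : 1 / M ^ 2 * X⁻¹ ≤ η / M / 2 := by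
    field_simp
    nlinarith
  have hfc' : 2 * ‖f c‖ ≤ ‖deriv f c‖ * (1 / M ^ 2 * X⁻¹) :=
    calc 2 * ‖f c‖ ≤ 2 * (A * (X ^ 2)⁻¹) := by gcongr
      _ ≤ a * X ^ 2 * (1 / M ^ 2 * X⁻¹) := by
        field_simp
        nlinarith [one_le_pow₀ hX (n := 2), mul_pos ha (one_pos.trans_le hX)]
      _ ≤ _ := by gcongr
  have hBr : 2 * (32 * (B * X ^ 2) / (η / M) ^ 2 * (1 / M ^ 2 * X⁻¹)) ≤ ‖deriv f c‖ :=
    calc 2 * (32 * (B * X ^ 2) / (η / M) ^ 2 * (1 / M ^ 2 * X⁻¹)) = 64 * B * X / η ^ 2 := by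
          field_simp
          ring
      _ ≤ a * X ^ 2 := by
        rw [div_le_iff₀ (by positivity)]
        nlinarith
      _ ≤ _ := hd
  obtain ⟨hexists, herror⟩ := existsUnique_root_near_newton_step (by positivity) hf hB
    (by positivity) hrR (norm_pos_iff.1 (lt_of_lt_of_le (by positivity) hd)) hfc' hBr
  refine ⟨hexists, fun w hw hfw => (herror w hw hfw).trans ?_⟩
  calc _ ≤ 4 * (32 * (B * X ^ 2) / (η / M) ^ 2) * (A * (X ^ 2)⁻¹) ^ 2 / (a * X ^ 2) ^ 3 := by
        gcongr
    _ = 128 * B * A ^ 2 / (η ^ 2 * a ^ 3) * (M ^ 2 * (X ^ 8)⁻¹) := by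
      field_simp
      ring
    _ ≤ _ := by
      gcongr
      field_simp
      exact hMX.trans (le_self_pow₀ hX (by norm_num))

theorem eventually_const_mul_pow_le_exp {k : ℝ} (hk : 0 < k) (A : ℝ) (n : ℕ) :
    ∀ᶠ M : ℝ in atTop, A * M ^ n ≤ Real.exp (k * M) := by
  have h : (fun M : ℝ => A * M ^ n) =o[atTop] fun M => Real.exp (k * M) :=
    (isLittleO_pow_exp_pos_mul_atTop n hk).const_mul_left A
  filter_upwards [h.bound zero_lt_one] with M hM
  simpa using (le_abs_self _).trans hM

theorem exists_newton_error_bound_of_exp_scale {k η A a B : ℝ} (hk : 0 < k) (hη : 0 < η)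
    (ha : 0 < a) :
    ∃ C : ℝ, ∀ᶠ M : ℝ in atTop, ∀ (f : ℂ → ℂ) (c : ℂ),
      DifferentiableOn ℂ f (ball c (η / M)) →
      (∀ w ∈ ball c (η / M), ‖f w‖ ≤ B * Real.exp (2 * k * M)) →
      ‖f c‖ ≤ A * Real.exp (-2 * k * M) → a * Real.exp (2 * k * M) ≤ ‖deriv f c‖ →
      (∃! w, ‖w - c‖ ≤ 1 / M ^ 2 * Real.exp (-k * M) ∧ f w = 0) ∧
        ∀ w, ‖w - c‖ ≤ 1 / M ^ 2 * Real.exp (-k * M) → f w = 0 →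
          ‖w - (c - f c / deriv f c)‖ ≤ C * Real.exp (-4 * k * M) := by
  refine ⟨128 * B * A ^ 2 / (η ^ 2 * a ^ 3), ?_⟩
  filter_upwards [eventually_ge_atTop 1, eventually_const_mul_pow_le_exp hk (2 / η) 0,
    eventually_const_mul_pow_le_exp hk (64 * B / (a * η ^ 2)) 0,
    eventually_const_mul_pow_le_exp hk (2 * A / a) 2,
    eventually_const_mul_pow_le_exp hk 1 2] with M hM hηX hBX hAX hMX f c
  have hpow (n : ℕ) : Real.exp (n * k * M) = Real.exp (k * M) ^ n := by
    rw [← Real.exp_nat_mul, mul_assoc]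
  have hpow' (n : ℕ) : Real.exp (-n * k * M) = (Real.exp (k * M) ^ n)⁻¹ := by
    rw [neg_mul, neg_mul, Real.exp_neg, hpow]
  rw [show Real.exp (-k * M) = (Real.exp (k * M))⁻¹ by rw [neg_mul, Real.exp_neg],
    show Real.exp (2 * k * M) = Real.exp (k * M) ^ 2 from mod_cast hpow 2,
    show Real.exp (-2 * k * M) = (Real.exp (k * M) ^ 2)⁻¹ from mod_cast hpow' 2,
    show Real.exp (-4 * k * M) = (Real.exp (k * M) ^ 4)⁻¹ from mod_cast hpow' 4]
  rw [pow_zero, mul_one, div_le_iff₀ (by positivity)] at hηX hBX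
  rw [div_mul_eq_mul_div, div_le_iff₀ ha] at hAX
  rw [one_mul] at hMX
  exact existsUnique_root_of_scale hη ha hM (Real.one_le_exp (by positivity)) hηX hBX hAX hMX

end Newton

section TruncatedBoundState

open Set Filter Topology MeasureTheory

theorem hasDerivAt_ite_le {F : Type*} [NormedAddCommGroup F] [NormedSpace ℝ F]
    {f g f' g' : ℝ → F} {c : ℝ} (hf : ∀ x, HasDerivAt f (f' x) x)
    (hg : ∀ x, HasDerivAt g (g' x) x) (h : f c = g c) (h' : f' c = g' c) (x : ℝ) :
    HasDerivAt (fun x => if x ≤ c then f x else g x) (if x ≤ c then f' x else g' x) x := by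
  have heq : EqOn (fun x => if x ≤ c then f x else g x) g (Ici c) := fun t ht => by
    rcases eq_or_lt_of_le (mem_Ici.1 ht) with rfl | hlt
    exacts [(if_pos le_rfl).trans h, if_neg hlt.not_ge]
  rcases lt_trichotomy x c with hx | rfl | hx
  · rw [if_pos hx.le]
    refine (hf x).congr_of_eventuallyEq ?_
    filter_upwards [Iio_mem_nhds hx] with t ht
    exact if_pos (le_of_lt ht)
  · rw [if_pos le_rfl, ← hasDerivWithinAt_univ, ← Iic_union_Ici (a := x)]
    refine HasDerivWithinAt.union ?_ ?_
    · exact (hf x).hasDerivWithinAt.congr (fun t ht => if_pos ht) (if_pos le_rfl)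
    · exact h' ▸ (hg x).hasDerivWithinAt.congr heq (heq self_mem_Ici)
  · rw [if_neg hx.not_ge]
    refine (hg x).congr_of_eventuallyEq ?_
    filter_upwards [Ioi_mem_nhds hx] with t ht
    exact heq (mem_Ici_of_Ioi ht)

theorem ite_sub_eq_integral_piecewise {F : Type*} [NormedAddCommGroup F] [NormedSpace ℝ F]
    {f g f' g' : ℝ → F} {c : ℝ} (hf : ∀ x, f x - f c = ∫ t in c..x, f' t)
    (hg : ∀ x, g x - g c = ∫ t in c..x, g' t) (h : f c = g c) (x : ℝ) :
    (if x ≤ c then f x else g x) - f c = ∫ t in c..x, (Iic c).piecewise f' g' t := by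
  rcases le_or_gt x c with hx | hx
  · rw [if_pos hx, hf]
    refine intervalIntegral.integral_congr_uIoo fun t ht => ?_
    rw [uIoo_of_ge hx] at ht
    exact (piecewise_eq_of_mem _ _ _ (mem_Iic.2 ht.2.le)).symm
  · rw [if_neg hx.not_ge, h, hg]
    refine intervalIntegral.integral_congr_uIoo fun t ht => ?_
    rw [uIoo_of_le hx.le] at ht
    exact (piecewise_eq_of_notMem _ _ _ (notMem_Iic.2 ht.1)).symm

/-- The part of `IsBoundState` that does not involve integrability of `Ψ`: a differentiable
solution of `-Ψ'' + W Ψ = lam Ψ` whose derivative is the primitive of `(W - lam) Ψ`. -/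
structure IsWeakSolution (W : ℝ → ℝ) (lam : ℝ) (Ψ : ℝ → ℂ) : Prop where
  differentiable : Differentiable ℝ Ψ
  integrable : ∀ x y : ℝ, IntervalIntegrable (fun t => ((W t : ℂ) - lam) * Ψ t) volume x y
  equation : ∀ x y : ℝ, deriv Ψ y - deriv Ψ x = ∫ t in x..y, ((W t : ℂ) - lam) * Ψ t

namespace IsWeakSolution

variable {W W₁ W₂ : ℝ → ℝ} {lam : ℝ} {Ψ f g : ℝ → ℂ}

theorem of_hasDerivAt {f' : ℝ → ℂ} (hW : Continuous W) (hf : ∀ x, HasDerivAt f (f' x) x)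
    (hf' : ∀ x, HasDerivAt f' (((W x : ℂ) - lam) * f x) x) : IsWeakSolution W lam f := by
  obtain rfl : deriv f = f' := funext fun x => (hf x).deriv
  have hdiff : Differentiable ℝ f := fun x => (hf x).differentiableAt
  have hcont : Continuous fun t => ((W t : ℂ) - lam) * f t := by
    have := hdiff.continuous
    fun_prop
  exact ⟨hdiff, fun _ _ => hcont.intervalIntegrable _ _, fun x y =>
    (intervalIntegral.integral_eq_sub_of_hasDerivAt (fun t _ => hf' t)
      (hcont.intervalIntegrable x y)).symm⟩

theorem congr_ae (h : IsWeakSolution W₁ lam Ψ) (hW : W₁ =ᵐ[volume] W₂) :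
    IsWeakSolution W₂ lam Ψ := by
  have hae : (fun t => ((W₁ t : ℂ) - lam) * Ψ t) =ᵐ[volume] fun t => ((W₂ t : ℂ) - lam) * Ψ t :=
    hW.mono fun t ht => by simp only [ht]
  refine ⟨h.differentiable, fun x y => (h.integrable x y).congr_ae (ae_restrict_of_ae hae),
    fun x y => ?_⟩
  rw [h.equation]
  exact intervalIntegral.integral_congr_ae (hae.mono fun t ht _ => ht)

theorem ite_le {c : ℝ} (hf : IsWeakSolution W₁ lam f) (hg : IsWeakSolution W₂ lam g)
    (h : f c = g c) (h' : deriv f c = deriv g c) :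
    IsWeakSolution (fun x => if x ≤ c then W₁ x else W₂ x) lam
      (fun x => if x ≤ c then f x else g x) := by
  have hd := hasDerivAt_ite_le (fun x => (hf.differentiable x).hasDerivAt)
    (fun x => (hg.differentiable x).hasDerivAt) h h'
  have hsource : (fun t => (((if t ≤ c then W₁ t else W₂ t : ℝ) : ℂ) - lam) *
      (if t ≤ c then f t else g t)) =
      (Iic c).piecewise (fun t => ((W₁ t : ℂ) - lam) * f t) fun t => ((W₂ t : ℂ) - lam) * g t := by
    funext t
    by_cases ht : t ≤ c <;> simp [piecewise, ht]
  have hint (x y : ℝ) : IntervalIntegrable ((Iic c).piecewise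
      (fun t => ((W₁ t : ℂ) - lam) * f t) fun t => ((W₂ t : ℂ) - lam) * g t) volume x y :=
    intervalIntegrable_iff.2 (Integrable.piecewise measurableSet_Iic
      (intervalIntegrable_iff.1 (hf.integrable x y)).integrableOn
      (intervalIntegrable_iff.1 (hg.integrable x y)).integrableOn)
  refine ⟨fun x => (hd x).differentiableAt, fun x y => hsource ▸ hint x y, fun x y => ?_⟩
  have hbase := ite_sub_eq_integral_piecewise (fun x => hf.equation c x)
    (fun x => hg.equation c x) h'
  rw [hsource, (hd x).deriv, (hd y).deriv, ← intervalIntegral.integral_interval_sub_left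
    (hint c y) (hint c x), ← hbase, ← hbase, sub_sub_sub_cancel_right]

end IsWeakSolution

theorem hasDerivAt_mul_exp (A : ℂ) (κ c x : ℝ) :
    HasDerivAt (fun x : ℝ => A * Complex.exp (κ * (x - c)))
      (κ * (A * Complex.exp (κ * (x - c)))) x := by
  have h : HasDerivAt (fun x : ℝ => (κ * (x - c) : ℂ)) (κ * 1) x :=
    ((Complex.ofRealCLM.hasDerivAt (x := x)).sub_const _).const_mul _
  exact (h.cexp.const_mul A).congr_deriv (by ring)

theorem isWeakSolution_mul_exp {κ lam : ℝ} (h : κ ^ 2 = -lam) (A : ℂ) (c : ℝ) :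
    IsWeakSolution (fun _ => 0) lam (fun x => A * Complex.exp (κ * (x - c))) := by
  refine .of_hasDerivAt continuous_const (hasDerivAt_mul_exp A κ c) fun x => ?_
  have h' : (κ : ℂ) ^ 2 = -lam := mod_cast h
  refine ((hasDerivAt_mul_exp A κ c x).const_mul (κ : ℂ)).congr_deriv ?_
  rw [Complex.ofReal_zero, zero_sub, ← h']
  ring

theorem memLp_mul_exp {S : Set ℝ} {κ : ℝ} (hS : IntegrableOn (fun x => Real.exp (2 * κ * x)) S)
    (A : ℂ) (c : ℝ) :
    MemLp (fun x : ℝ => A * Complex.exp (κ * (x - c))) 2 (volume.restrict S) := by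
  have hcont : Continuous fun x : ℝ => A * Complex.exp (κ * (x - c)) :=
    continuous_iff_continuousAt.2 fun x => (hasDerivAt_mul_exp A κ c x).continuousAt
  rw [memLp_two_iff_integrable_sq_norm hcont.aestronglyMeasurable]
  have hsq (x : ℝ) : ‖A * Complex.exp (κ * (x - c))‖ ^ 2 =
      ‖A‖ ^ 2 * Real.exp (-(2 * κ * c)) * Real.exp (2 * κ * x) := by
    rw [norm_mul, Complex.norm_exp, mul_pow, ← Real.exp_nat_mul, mul_assoc, ← Real.exp_add]
    congr 2
    simp
    ring
  simp only [hsq]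
  exact hS.const_mul _

theorem truncPotential_ae_eq (V : ℝ → ℝ) (M : ℝ) :
    (fun x => if x ≤ -M then 0 else if x ≤ M then V x else 0) =ᵐ[volume] truncPotential V M := by
  filter_upwards [volume.ae_ne (-M)] with x hx
  by_cases h₁ : x ≤ -M
  · rw [if_pos h₁, truncPotential, if_neg fun h => hx (le_antisymm h₁ (abs_le.1 h).1)]
  · simp only [if_neg h₁, truncPotential, abs_le, (not_le.1 h₁).le, true_and]

theorem memLp_ite_le {F : Type*} [NormedAddCommGroup F] {μ : Measure ℝ} {p : ENNReal} {f g : ℝ → F}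
    {c : ℝ} (hf : MemLp f p (μ.restrict (Iic c))) (hg : MemLp g p (μ.restrict (Ioi c))) :
    MemLp (fun x => if x ≤ c then f x else g x) p μ := by
  have h : MemLp ((Iic c).piecewise f g) p μ :=
    hf.piecewise measurableSet_Iic ((compl_Iic (a := c)).symm ▸ hg)
  exact h

theorem memLp_two_of_exp_tails {y : ℝ → ℂ} (hy : Continuous y) {κ : ℝ} (hκ : 0 < κ) (A B : ℂ)
    (c d : ℝ) :
    MemLp (fun x : ℝ => if x ≤ c then A * Complex.exp (κ * (x - c))
      else if x ≤ d then y x else B * Complex.exp ((-κ : ℝ) * (x - d))) 2 volume := by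
  refine memLp_ite_le (memLp_mul_exp (integrableOn_exp_mul_Iic (by positivity) _) A c)
    (memLp_ite_le ?_ ?_)
  · obtain ⟨K, hK⟩ := isCompact_Icc.exists_bound_of_continuousOn (s := Icc c d) hy.continuousOn
    rw [Measure.restrict_restrict measurableSet_Iic, inter_comm, Ioi_inter_Iic]
    exact .of_bound hy.aestronglyMeasurable K
      (ae_restrict_of_forall_mem measurableSet_Ioc fun x hx => hK x (Ioc_subset_Icc_self hx))
  · refine (memLp_mul_exp (S := Ioi d) ?_ B d).mono_measure
      (Measure.restrict_mono_measure Measure.restrict_le_self _)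
    exact integrableOn_exp_mul_Ioi (by linarith) d

/-- The bound state is `y` on `[-M, M]`, continued by the decaying exponentials on both sides. -/
theorem exists_isBoundState_truncPotential {V : ℝ → ℝ} (hV : Continuous V) {lam κ M : ℝ}
    {a b : ℂ} {y : ℝ → ℂ} (hy : IsSchrodingerIVP V lam a b y) (hM : 0 < M) (hκ : 0 < κ)
    (hlam : κ ^ 2 = -lam) (hne : a ≠ 0 ∨ b ≠ 0) (hleft : deriv y (-M) = κ * y (-M))
    (hright : deriv y M = -κ * y M) :
    ∃ Ψ : ℝ → ℂ, IsBoundState (truncPotential V M) lam Ψ := by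
  have hcore := IsWeakSolution.of_hasDerivAt hV hy.hasDerivAt hy.hasDerivAt_deriv
  have htailL := isWeakSolution_mul_exp hlam (y (-M)) (-M)
  have htailR := isWeakSolution_mul_exp (κ := -κ) (by rwa [neg_sq]) (y M) M
  have hmid := hcore.ite_le (c := M) htailR (by simp) (by
    rw [(hasDerivAt_mul_exp _ _ _ _).deriv, hright]
    simp)
  have hneg : -M ≤ M := by linarith
  have hmidL : deriv (fun x => if x ≤ M then y x else y M * Complex.exp ((-κ : ℝ) * (x - M))) (-M) =
      deriv y (-M) := Filter.EventuallyEq.deriv_eq <| by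
    filter_upwards [Iio_mem_nhds (show -M < M by linarith)] with x hx
    exact if_pos (le_of_lt hx)
  have hsol := (htailL.ite_le (c := -M) hmid (by simp [hneg]) (by
    rw [(hasDerivAt_mul_exp _ _ _ _).deriv, hmidL, hleft]
    simp)).congr_ae (truncPotential_ae_eq V M)
  refine ⟨_, memLp_two_of_exp_tails hy.continuous hκ (y (-M)) (y M) (-M) M, fun h₀ => ?_,
    hsol.differentiable, hsol.integrable, hsol.equation⟩
  have hzero : y =ᶠ[𝓝 0] fun _ => 0 := by
    filter_upwards [Ioo_mem_nhds (neg_lt_zero.2 hM) hM] with x hx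
    simpa [hx.1.not_ge, hx.2.le] using congrFun h₀ x
  rcases hne with ha | hb
  · exact ha (hy.value_zero ▸ hzero.eq_of_nhds)
  · exact hb (hy.deriv_zero ▸ hzero.deriv_eq.trans (deriv_const _ _))

end TruncatedBoundState

section Parity

open MeasureTheory

variable {V : ℝ → ℝ} {z a b : ℂ} {y : ℝ → ℂ}

theorem IsBoundState.isSchrodingerIVP (hV : Continuous V) {E : ℝ} {Φ : ℝ → ℂ}
    (hΦ : IsBoundState V E Φ) : IsSchrodingerIVP V E (Φ 0) (deriv Φ 0) Φ := by
  refine .of_hasDerivAt (fun x => (hΦ.differentiable x).hasDerivAt) (fun x => ?_) rfl rfl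
  have hc : Continuous fun t => ((V t : ℂ) - E) * Φ t := by
    have := hΦ.differentiable.continuous
    fun_prop
  have hprimitive : deriv Φ = fun x => deriv Φ 0 + ∫ t in (0 : ℝ)..x, ((V t : ℂ) - E) * Φ t :=
    funext fun x => by rw [← hΦ.equation 0 x, add_sub_cancel]
  rw [hprimitive]
  exact (intervalIntegral.integral_hasDerivAt_right (hc.intervalIntegrable _ _)
    (hc.stronglyMeasurableAtFilter _ _) hc.continuousAt).const_add _

namespace IsSchrodingerIVP

theorem add_comp_neg_eq (hV : Continuous V) (hEven : ∀ x, V (-x) = V x)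
    (hy : IsSchrodingerIVP V z a b y) (x : ℝ) :
    y x + y (-x) = 2 * a * schrodingerSol V z 1 0 x := by
  have h := hy.add (hy.comp_neg hEven)
  have h' := (schrodingerSol_spec hV z 1 0).const_mul (2 * a)
  rw [add_neg_cancel, ← two_mul] at h
  rw [mul_one, mul_zero] at h'
  exact congrFun (h.unique hV h') x

theorem sub_comp_neg_eq (hV : Continuous V) (hEven : ∀ x, V (-x) = V x)
    (hy : IsSchrodingerIVP V z a b y) (x : ℝ) :
    y x - y (-x) = 2 * b * schrodingerSol V z 0 1 x := by
  have h := hy.add ((hy.comp_neg hEven).const_mul (-1))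
  have h' := (schrodingerSol_spec hV z 0 1).const_mul (2 * b)
  simp only [neg_one_mul, add_neg_cancel, neg_neg, ← two_mul, ← sub_eq_add_neg] at h
  rw [mul_one, mul_zero] at h'
  exact congrFun (h.unique hV h') x

theorem deriv_neg_eq_of_deriv_eq (hV : Continuous V) (hEven : ∀ x, V (-x) = V x)
    (hab : a = 0 ∨ b = 0) (hy : IsSchrodingerIVP V z a b y) {κ : ℂ} {M : ℝ}
    (h : deriv y M = -κ * y M) : deriv y (-M) = κ * y (-M) := by
  obtain ⟨σ, hσ⟩ : ∃ σ : ℂ, (fun x => y (-x)) = fun x => σ * y x := by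
    rcases hab with rfl | rfl
    · refine ⟨-1, funext fun x => ?_⟩
      linear_combination hy.add_comp_neg_eq hV hEven x
    · refine ⟨1, funext fun x => ?_⟩
      linear_combination -(hy.sub_comp_neg_eq hV hEven x)
  have hd : -deriv y (-M) = σ * deriv y M := by
    rw [← deriv_comp_neg, hσ, deriv_const_mul_field]
  have hM : y (-M) = σ * y M := congrFun hσ M
  linear_combination -hd - σ * h - κ * hM

end IsSchrodingerIVP

theorem memLp_of_const_mul {y w : ℝ → ℂ} {c : ℂ} (hc : c ≠ 0) (hw : MemLp w 2 volume)
    (h : ∀ x, w x = c * y x) : MemLp y 2 volume := by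
  have hy : y = fun x => c⁻¹ * w x := funext fun x => by rw [h, inv_mul_cancel_left₀ hc]
  exact hy ▸ hw.const_mul _

namespace IsBoundState

variable {E : ℝ} {Φ : ℝ → ℂ}

theorem memLp_comp_neg (hΦ : IsBoundState V E Φ) : MemLp (fun x => Φ (-x)) 2 volume :=
  hΦ.memLp.comp_measurePreserving (Measure.measurePreserving_neg volume)

theorem memLp_schrodingerSol_of_even (hΦ : IsBoundState V E Φ) (hV : Continuous V)
    (hEven : ∀ x, V (-x) = V x) (h : ∀ x, Φ (-x) = Φ x) :
    MemLp (schrodingerSol V E 1 0) 2 volume := by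
  have hadd := (hΦ.isSchrodingerIVP hV).add_comp_neg_eq hV hEven
  refine memLp_of_const_mul (fun h₀ => hΦ.ne_zero (funext fun x => ?_))
    (hΦ.memLp.add hΦ.memLp_comp_neg) hadd
  have hx := hadd x
  rw [h₀, h] at hx
  simpa using hx

theorem memLp_schrodingerSol_of_not_even (hΦ : IsBoundState V E Φ) (hV : Continuous V)
    (hEven : ∀ x, V (-x) = V x) (h : ¬ ∀ x, Φ (-x) = Φ x) :
    MemLp (schrodingerSol V E 0 1) 2 volume := by
  have hsub := (hΦ.isSchrodingerIVP hV).sub_comp_neg_eq hV hEven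
  refine memLp_of_const_mul (fun h₀ => h fun x => ?_) (hΦ.memLp.sub hΦ.memLp_comp_neg) hsub
  have hx := hsub x
  rw [h₀, zero_mul] at hx
  exact (sub_eq_zero.1 hx).symm

theorem exists_initial_data (hΦ : IsBoundState V E Φ) (hV : Continuous V)
    (hEven : ∀ x, V (-x) = V x) :
    ∃ p q r s : ℝ, p * s - q * r = 1 ∧ (p = 0 ∨ q = 0) ∧
      (∀ z, uSol V Φ z = schrodingerSol V z p q) ∧
      (∀ z, vSol V Φ z = schrodingerSol V z r s) ∧ MemLp (uSol V Φ E) 2 volume := by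
  by_cases h : ∀ x, Φ (-x) = Φ x
  · simp only [uSol, vSol, if_pos h]
    exact ⟨1, 0, 0, 1, by norm_num, .inr rfl, by simp, by simp,
      hΦ.memLp_schrodingerSol_of_even hV hEven h⟩
  · simp only [uSol, vSol, if_neg h]
    exact ⟨0, 1, -1, 0, by norm_num, .inl rfl, by simp, by simp,
      hΦ.memLp_schrodingerSol_of_not_even hV hEven h⟩

end IsBoundState

end Parity

section Matching

/-- The exponent `√(-z) = -i √z`: the solutions of `-y'' = z y` decaying at `+∞` are the multiples
of `exp (-√(-z) x)`. -/
noncomputable def decayRate (z : ℂ) : ℂ := (-z) ^ (1 / 2 : ℂ)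

theorem I_mul_sqrtUpper (z : ℂ) : Complex.I * sqrtUpper z = -decayRate z := by
  rw [sqrtUpper, decayRate, ← mul_assoc, Complex.I_mul_I, neg_one_mul]

theorem decayRate_sq (z : ℂ) : decayRate z ^ 2 = -z := by
  have h := sqrtUpper_sq z
  rw [sqrtUpper, mul_pow, Complex.I_sq] at h
  rw [decayRate]
  linear_combination -h

theorem norm_decayRate_le (z : ℂ) : ‖decayRate z‖ ≤ 1 + ‖z‖ := by
  have h : ‖decayRate z‖ ^ 2 = ‖z‖ := by rw [← norm_pow, decayRate_sq, norm_neg]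
  nlinarith [sq_nonneg (‖decayRate z‖ - 1)]

theorem decayRate_ofReal {x : ℝ} (hx : x < 0) : decayRate x = √(-x) := by
  rw [decayRate, Real.sqrt_eq_rpow, Complex.ofReal_cpow (by linarith)]
  push_cast
  rfl

theorem neg_mem_slitPlane_of_re_neg {z : ℂ} (hz : z.re < 0) : -z ∈ Complex.slitPlane :=
  .inl (by simpa using hz)

theorem differentiableAt_decayRate {z : ℂ} (hz : z.re < 0) : DifferentiableAt ℂ decayRate z :=
  ((hasDerivAt_neg z).cpow_const (neg_mem_slitPlane_of_re_neg hz)).differentiableAt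

theorem decayRate_conj {z : ℂ} (hz : z.re < 0) :
    decayRate (starRingEnd ℂ z) = starRingEnd ℂ (decayRate z) := by
  rw [decayRate, decayRate, ← map_neg, Complex.conj_cpow _ _
    (Complex.mem_slitPlane_iff_arg.1 (neg_mem_slitPlane_of_re_neg hz)).1, map_div₀, map_one,
    map_ofNat]

/-- The Robin boundary form `y' + m y` of the Cauchy data `(y, y')`. -/
def robin (m : ℂ) (w : ℂ × ℂ) : ℂ := w.2 + m * w.1

theorem norm_robin_le (m : ℂ) (w : ℂ × ℂ) : ‖robin m w‖ ≤ (1 + ‖m‖) * ‖w‖ :=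
  calc ‖robin m w‖ ≤ ‖w.2‖ + ‖m‖ * ‖w.1‖ := (norm_add_le _ _).trans_eq (by rw [norm_mul])
    _ ≤ ‖w‖ + ‖m‖ * ‖w‖ := by gcongr; exacts [norm_snd_le w, norm_fst_le w]
    _ = (1 + ‖m‖) * ‖w‖ := by ring

theorem mul_norm_cauchyData_le_norm_robin {v : ℝ → ℂ} {z : ℂ} {δ M : ℝ} (hδ : 0 ≤ δ)
    (h : δ * (‖v M‖ + ‖deriv v M‖) ≤ ‖deriv v M - Complex.I * sqrtUpper z * v M‖) :
    δ * ‖cauchyData v M‖ ≤ ‖robin (decayRate z) (cauchyData v M)‖ := by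
  rw [I_mul_sqrtUpper, neg_mul, sub_neg_eq_add] at h
  refine (mul_le_mul_of_nonneg_left ?_ hδ).trans h
  exact max_le_add_of_nonneg (norm_nonneg _) (norm_nonneg _)

theorem robin_volterraKernel (m : ℂ) (u v y : ℝ → ℂ) (x : ℝ) :
    robin m (volterraKernel u v y x) =
      (∫ t in (0 : ℝ)..x, v t * y t) * robin m (cauchyData u x) -
        (∫ t in (0 : ℝ)..x, u t * y t) * robin m (cauchyData v x) := by
  simp only [robin, volterraKernel, Prod.fst_sub, Prod.snd_sub, Prod.smul_fst, Prod.smul_snd,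
    smul_eq_mul]
  ring

/-- The function of `z` whose roots are the energies at which the solution with initial data
`(p, q)` at `0` matches a decaying exponential at `M`; `Theta` is of this form. -/
noncomputable def matching (V : ℝ → ℝ) (p q : ℂ) (M : ℝ) (z : ℂ) : ℂ :=
  robin (decayRate z) (cauchyData (schrodingerSol V z p q) M)

theorem Theta_eq_matching {V : ℝ → ℝ} {Φ : ℝ → ℂ} {p q : ℂ}
    (hu : ∀ z, uSol V Φ z = schrodingerSol V z p q) (M : ℝ) : Theta V Φ M = matching V p q M := by
  funext z
  simp only [Theta, matching, robin, cauchyData, I_mul_sqrtUpper, hu, neg_mul, sub_neg_eq_add]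

variable {V : ℝ → ℝ}

theorem schrodingerSol_conj (hV : Continuous V) (z : ℂ) (p q : ℝ) :
    schrodingerSol V (starRingEnd ℂ z) p q = fun x => starRingEnd ℂ (schrodingerSol V z p q x) := by
  have h := (schrodingerSol_spec hV z p q).conj
  rw [Complex.conj_ofReal, Complex.conj_ofReal] at h
  exact (schrodingerSol_spec hV _ p q).unique hV h

theorem matching_conj (hV : Continuous V) (p q M : ℝ) {z : ℂ} (hz : z.re < 0) :
    matching V p q M (starRingEnd ℂ z) = starRingEnd ℂ (matching V p q M z) := by
  have hd := ((schrodingerSol_spec hV z p q).hasDerivAt M).star.deriv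
  simp only [matching, robin, cauchyData, schrodingerSol_conj hV, decayRate_conj hz, map_add,
    map_mul]
  exact congrArg (· + _) hd

theorem exists_isBoundState_of_matching_eq_zero (hV : Continuous V) (hEven : ∀ x, V (-x) = V x)
    {p q : ℂ} (hpq : p = 0 ∨ q = 0) (hne : p ≠ 0 ∨ q ≠ 0) {e M : ℝ} (he : e < 0) (hM : 0 < M)
    (h : matching V p q M e = 0) : ∃ Ψ : ℝ → ℂ, IsBoundState (truncPotential V M) e Ψ := by
  have hy := schrodingerSol_spec hV e p q
  have hright : deriv (schrodingerSol V e p q) M = -(√(-e) : ℂ) * schrodingerSol V e p q M := by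
    rw [← decayRate_ofReal he, neg_mul]
    exact eq_neg_of_add_eq_zero_left h
  exact exists_isBoundState_truncPotential hV hy hM (Real.sqrt_pos.2 (by linarith))
    (Real.sq_sqrt (by linarith)) hne (hy.deriv_neg_eq_of_deriv_eq hV hEven hpq hright) hright

theorem isFundamentalPair_schrodingerSol (hV : Continuous V) {p q r s : ℂ}
    (hdet : p * s - q * r = 1) (z : ℂ) :
    IsFundamentalPair V z p q r s (schrodingerSol V z p q) (schrodingerSol V z r s) :=
  ⟨schrodingerSol_spec hV z p q, schrodingerSol_spec hV z r s, hdet⟩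

theorem hasDerivAt_matching (hV : Continuous V) {p q r s : ℂ} (hdet : p * s - q * r = 1) {z : ℂ}
    (hz : z.re < 0) {M : ℝ} (hM : 0 ≤ M) :
    HasDerivAt (matching V p q M) (deriv decayRate z * schrodingerSol V z p q M +
      robin (decayRate z) (volterraKernel (schrodingerSol V z p q) (schrodingerSol V z r s)
        (schrodingerSol V z p q) M)) z := by
  have h := (isFundamentalPair_schrodingerSol hV hdet z).hasDerivAt_cauchyData_param
    (y := fun z => schrodingerSol V z p q) (fun z => schrodingerSol_spec hV z p q) hM
  have hfst := (ContinuousLinearMap.fst ℂ ℂ ℂ).hasFDerivAt.comp_hasDerivAt z h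
  have hsnd := (ContinuousLinearMap.snd ℂ ℂ ℂ).hasFDerivAt.comp_hasDerivAt z h
  refine (hsnd.add ((differentiableAt_decayRate hz).hasDerivAt.mul hfst)).congr_deriv ?_
  simp only [robin, Function.comp_apply, ContinuousLinearMap.coe_fst', cauchyData,
    ContinuousLinearMap.coe_snd']
  ring

theorem differentiableOn_matching (hV : Continuous V) {p q r s : ℂ} (hdet : p * s - q * r = 1)
    {M : ℝ} (hM : 0 ≤ M) : DifferentiableOn ℂ (matching V p q M) {z | z.re < 0} :=
  fun _ hz => (hasDerivAt_matching hV hdet hz hM).differentiableAt.differentiableWithinAt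

end Matching

section MatchingEstimates

open Set Filter Topology MeasureTheory Metric

theorem IsFundamentalPair.exists_pos_le_norm_integral_sq {V : ℝ → ℝ} {z p q r s : ℂ} {u v : ℝ → ℂ}
    (hF : IsFundamentalPair V z p q r s u v) (hreal : ∀ x, starRingEnd ℂ (u x) = u x) :
    ∃ c : ℝ, 0 < c ∧ ∀ M, 1 ≤ M → c ≤ ‖∫ t in (0 : ℝ)..M, u t * u t‖ := by
  have hc : Continuous fun t => ‖u t‖ ^ 2 := by
    have := hF.left.continuous
    fun_prop
  refine ⟨∫ t in (0 : ℝ)..1, ‖u t‖ ^ 2, ?_, fun M hM => ?_⟩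
  · refine intervalIntegral.integral_pos one_pos hc.continuousOn (fun t _ => by positivity) ?_
    by_contra! hle
    have hzero : u =ᶠ[𝓝 (1 / 2 : ℝ)] fun _ => (0 : ℂ) := by
      filter_upwards [Icc_mem_nhds (show (0 : ℝ) < 1 / 2 by norm_num)
        (show (1 / 2 : ℝ) < 1 by norm_num)] with t ht
      simpa using (hle t ht).antisymm (by positivity)
    have hW := hF.wronskian_eq_one (1 / 2)
    rw [wronskian, hzero.eq_of_nhds, hzero.deriv_eq, deriv_const] at hW
    simp at hW
  · have hsq : ∀ t, u t * u t = ((‖u t‖ ^ 2 : ℝ) : ℂ) := fun t => by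
      rw [← Complex.normSq_eq_norm_sq, ← Complex.mul_conj, hreal]
    simp only [hsq]
    rw [intervalIntegral.integral_ofReal, Complex.norm_real]
    exact (intervalIntegral.integral_mono_interval le_rfl zero_le_one hM
      (ae_of_all _ fun t => by positivity) (hc.intervalIntegrable _ _)).trans (le_abs_self _)

namespace HasDichotomy

variable {V : ℝ → ℝ} {z₀ z p q r s : ℂ} {u v : ℝ → ℂ} {C lam M : ℝ}

theorem const_pos (h : HasDichotomy u v C lam M) (hF : IsFundamentalPair V z₀ p q r s u v)
    (hM : 0 ≤ M) : 0 < C := by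
  refine (h.const_nonneg hM).lt_of_ne' fun h₀ => ?_
  have := h.exp_le_norm_cauchyData_right hF hM
  rw [h₀, mul_zero, zero_mul] at this
  exact this.not_gt (Real.exp_pos _)

theorem norm_robin_left_le (h : HasDichotomy u v C lam M) (hM : 0 ≤ M) (m : ℂ) :
    ‖robin m (cauchyData u M)‖ ≤ (1 + ‖m‖) * C * Real.exp (-lam * M) := by
  rw [mul_assoc]
  exact (norm_robin_le _ _).trans (by gcongr; exact h.left M ⟨hM, le_rfl⟩)

theorem norm_matching_le (h : HasDichotomy u v C lam M) (hF : IsFundamentalPair V z₀ p q r s u v)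
    (hV : Continuous V) (hM : 0 ≤ M) (hz : 4 * C ^ 2 * M * ‖z - z₀‖ ≤ 1) :
    ‖matching V p q M z‖ ≤ (1 + ‖decayRate z‖) * (2 * C * Real.exp (lam * M)) :=
  (norm_robin_le _ _).trans <| by
    gcongr
    exact h.norm_cauchyData_le hF (schrodingerSol_spec hV z p q) hz ⟨hM, le_rfl⟩

theorem norm_integral_right_mul_left_le (h : HasDichotomy u v C lam M) (hM : 0 ≤ M) :
    ‖∫ t in (0 : ℝ)..M, v t * u t‖ ≤ C ^ 2 * M := by
  refine norm_integral_zero_le hM fun t ht => ?_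
  refine (norm_mul_le_of_le ((norm_le_norm_cauchyData v t).trans (h.right t ht))
    ((norm_le_norm_cauchyData u t).trans (h.left t ht))).trans_eq ?_
  rw [neg_mul, Real.exp_neg]
  field_simp

theorem norm_left_terms_le (h : HasDichotomy u v C lam M) (hM : 1 ≤ M) (m m' : ℂ) :
    ‖m' * u M + (∫ t in (0 : ℝ)..M, v t * u t) * robin m (cauchyData u M)‖ ≤
      (‖m'‖ * C + (1 + ‖m‖) * C ^ 3) * M := by
  have hM₀ : 0 ≤ M := zero_le_one.trans hM
  have hC := h.const_nonneg hM₀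
  have hexp : Real.exp (-lam * M) ≤ 1 :=
    Real.exp_le_one_iff.2 (by nlinarith [mul_nonneg h.rate_nonneg hM₀])
  have hu : ‖u M‖ ≤ C := ((norm_le_norm_cauchyData u M).trans (h.left M ⟨hM₀, le_rfl⟩)).trans
    (mul_le_of_le_one_right hC hexp)
  have hrobin : ‖robin m (cauchyData u M)‖ ≤ (1 + ‖m‖) * C :=
    (h.norm_robin_left_le hM₀ m).trans (mul_le_of_le_one_right (by positivity) hexp)
  calc _ ≤ ‖m'‖ * C + C ^ 2 * M * ((1 + ‖m‖) * C) :=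
        norm_add_le_of_le (norm_mul_le_of_le le_rfl hu)
          (norm_mul_le_of_le (h.norm_integral_right_mul_left_le hM₀) hrobin)
    _ ≤ ‖m'‖ * C * M + C ^ 2 * M * ((1 + ‖m‖) * C) := by
        gcongr ?_ + _
        exact le_mul_of_one_le_right (by positivity) hM
    _ = _ := by ring

theorem mul_exp_sub_le_norm_robin_volterraKernel (h : HasDichotomy u v C lam M)
    (hF : IsFundamentalPair V z₀ p q r s u v) (hM : 1 ≤ M) {c δ : ℝ} (hδ : 0 ≤ δ) (hc : 0 ≤ c)
    (hsq : c ≤ ‖∫ t in (0 : ℝ)..M, u t * u t‖) (m m' : ℂ)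
    (hnd : δ * ‖cauchyData v M‖ ≤ ‖robin m (cauchyData v M)‖) :
    c * δ / (2 * C) * Real.exp (lam * M) - (‖m'‖ * C + (1 + ‖m‖) * C ^ 3) * M ≤
      ‖m' * u M + robin m (volterraKernel u v u M)‖ := by
  have hM₀ : 0 ≤ M := zero_le_one.trans hM
  have hC := h.const_pos hF hM₀
  have hmain : c * δ / (2 * C) * Real.exp (lam * M) ≤
      ‖(∫ t in (0 : ℝ)..M, u t * u t) * robin m (cauchyData v M)‖ :=
    calc c * δ / (2 * C) * Real.exp (lam * M)
        ≤ c * δ / (2 * C) * (2 * C * ‖cauchyData v M‖) := by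
          gcongr
          exact h.exp_le_norm_cauchyData_right hF hM₀
      _ = c * (δ * ‖cauchyData v M‖) := by field_simp
      _ ≤ _ := by
          rw [norm_mul]
          gcongr
  rw [robin_volterraKernel, ← add_sub_assoc, norm_sub_rev]
  exact (sub_le_sub hmain (h.norm_left_terms_le hM m m')).trans (norm_sub_norm_le _ _)

end HasDichotomy

theorem re_neg_of_norm_sub_lt {E : ℝ} {z : ℂ} (h : ‖z - E‖ < -E) : z.re < 0 := by
  have := (Complex.re_le_norm (z - E)).trans_lt h
  rw [Complex.sub_re, Complex.ofReal_re] at this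
  linarith

theorem eventually_root_radius_lt {k E : ℝ} (hk : 0 < k) (hE : E < 0) :
    ∀ᶠ M : ℝ in atTop, 1 / M ^ 2 * Real.exp (-k * M) < -E := by
  have hexp : Tendsto (fun M : ℝ => Real.exp (-k * M)) atTop (𝓝 0) :=
    Real.tendsto_exp_atBot.comp (tendsto_id.const_mul_atTop_of_neg (neg_lt_zero.2 hk))
  filter_upwards [hexp.eventually_lt_const (neg_pos.2 hE), eventually_ge_atTop 1] with M hM hM₁
  refine (mul_le_of_le_one_left (Real.exp_pos _).le ?_).trans_lt hM
  rw [one_div]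
  exact inv_le_one_of_one_le₀ (one_le_pow₀ hM₁)

theorem exists_real_root_of_conj {f : ℂ → ℂ} {E R : ℝ} (hR : R < -E)
    (hf : ∀ z : ℂ, z.re < 0 → f (starRingEnd ℂ z) = starRingEnd ℂ (f z))
    (h : ∃! w : ℂ, ‖w - E‖ ≤ R ∧ f w = 0) :
    ∃ e : ℝ, e < 0 ∧ ‖(e : ℂ) - E‖ ≤ R ∧ f e = 0 ∧ ∀ z : ℂ, ‖z - E‖ ≤ R → f z = 0 → z = e := by
  obtain ⟨w, ⟨hw, hw₀⟩, huniq⟩ := h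
  have hre := re_neg_of_norm_sub_lt (hw.trans_lt hR)
  have hconj : starRingEnd ℂ w = w := huniq _ ⟨by
    rwa [← Complex.conj_ofReal E, ← map_sub, Complex.norm_conj], by rw [hf w hre, hw₀, map_zero]⟩
  obtain ⟨e, rfl⟩ := Complex.conj_eq_iff_real.1 hconj
  exact ⟨e, hre, hw, hw₀, fun z hz hz₀ => huniq z ⟨hz, hz₀⟩⟩

variable {V : ℝ → ℝ} {p q r s E C lam M η : ℝ}

theorem HasDichotomy.norm_matching_le_of_mem_ball (hV : Continuous V) (hE : E < 0)
    (hdet : (p * s - q * r : ℂ) = 1)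
    (h : HasDichotomy (schrodingerSol V E p q) (schrodingerSol V E r s) C lam M) (hM : 1 ≤ M)
    (hη : 4 * C ^ 2 * η ≤ 1) (hηE : η ≤ -E) {w : ℂ} (hw : w ∈ ball (E : ℂ) (η / M)) :
    ‖matching V p q M w‖ ≤ (2 - 2 * E) * (2 * C) * Real.exp (lam * M) := by
  have hM₀ : 0 < M := one_pos.trans_le hM
  have hC := h.const_nonneg hM₀.le
  have hclose : M * ‖w - E‖ ≤ η := by
    rw [mem_ball, dist_eq_norm, lt_div_iff₀' hM₀] at hw
    exact hw.le
  have hscale : 4 * C ^ 2 * M * ‖w - E‖ ≤ 1 := by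
    rw [mul_assoc]
    exact (mul_le_mul_of_nonneg_left hclose (by positivity)).trans hη
  have hdist : ‖w - E‖ ≤ -E :=
    ((le_mul_of_one_le_left (norm_nonneg _) hM).trans hclose).trans hηE
  have hnorm : ‖w‖ ≤ -E + -E := by
    simpa [abs_of_neg hE] using norm_add_le_of_le hdist (le_refl ‖(E : ℂ)‖)
  have hrate : 1 + ‖decayRate w‖ ≤ 2 - 2 * E := by linarith [norm_decayRate_le w]
  calc ‖matching V p q M w‖ ≤ (1 + ‖decayRate w‖) * (2 * C * Real.exp (lam * M)) :=
        h.norm_matching_le (isFundamentalPair_schrodingerSol hV hdet E) hV hM₀.le hscale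
    _ ≤ (2 - 2 * E) * (2 * C * Real.exp (lam * M)) := by gcongr
    _ = _ := (mul_assoc _ _ _).symm

theorem HasDichotomy.eventually_exp_le_norm_deriv_matching (hV : Continuous V) (hE : E < 0)
    (hdet : (p * s - q * r : ℂ) = 1) (hlam : 0 < lam) (hC : 0 < C)
    (h : ∀ M, HasDichotomy (schrodingerSol V E p q) (schrodingerSol V E r s) C lam M) {c δ : ℝ}
    (hc : 0 < c) (hδ : 0 < δ) (hsq : ∀ M, 1 ≤ M →
      c ≤ ‖∫ t in (0 : ℝ)..M, schrodingerSol V E p q t * schrodingerSol V E p q t‖) :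
    ∀ᶠ M in atTop, δ * ‖cauchyData (schrodingerSol V E r s) M‖ ≤
      ‖robin (decayRate E) (cauchyData (schrodingerSol V E r s) M)‖ →
      c * δ / (4 * C) * Real.exp (lam * M) ≤ ‖deriv (matching V p q M) E‖ := by
  set K := ‖deriv decayRate E‖ * C + (1 + ‖decayRate E‖) * C ^ 3
  have hF := isFundamentalPair_schrodingerSol hV hdet E
  filter_upwards [eventually_const_mul_pow_le_exp hlam (K / (c * δ / (4 * C))) 1,
    eventually_ge_atTop 1] with M hexp hM hnd
  rw [(hasDerivAt_matching hV hdet (by simpa using hE) (zero_le_one.trans hM)).deriv]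
  have hlower := (h M).mul_exp_sub_le_norm_robin_volterraKernel hF hM hδ.le hc.le (hsq M hM)
    (decayRate E) (deriv decayRate E) hnd
  have hsmall : K * M ≤ c * δ / (4 * C) * Real.exp (lam * M) := by
    rwa [pow_one, div_mul_eq_mul_div, div_le_iff₀' (by positivity)] at hexp
  have hhalf : c * δ / (2 * C) * Real.exp (lam * M) =
      2 * (c * δ / (4 * C) * Real.exp (lam * M)) := by ring
  linarith

theorem exists_newton_error_bound_matching (hV : Continuous V) (hE : E < 0)
    (hdet : (p * s - q * r : ℂ) = 1) {R T : ℝ} (hT : 0 < T) (hper : ∀ x, R < x → V (x + T) = V x)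
    (hL : MemLp (schrodingerSol V E p q) 2 volume) :
    ∃ k : ℝ, 0 < k ∧ ∀ δ : ℝ, 0 < δ → ∃ C : ℝ, ∀ᶠ M : ℝ in atTop,
      δ * ‖cauchyData (schrodingerSol V E r s) M‖ ≤
        ‖robin (decayRate E) (cauchyData (schrodingerSol V E r s) M)‖ →
      deriv (matching V p q M) E ≠ 0 ∧
      (∃! w : ℂ, ‖w - E‖ ≤ 1 / M ^ 2 * Real.exp (-k * M) ∧ matching V p q M w = 0) ∧
      ∀ w : ℂ, ‖w - E‖ ≤ 1 / M ^ 2 * Real.exp (-k * M) → matching V p q M w = 0 →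
        ‖w - (E - matching V p q M E / deriv (matching V p q M) E)‖ ≤
          C * Real.exp (-4 * k * M) := by
  have hF := isFundamentalPair_schrodingerSol hV hdet E
  obtain ⟨lam, C, hlam, hD⟩ := hF.exists_hasDichotomy hV hT hper hL
  have hC := (hD 0).const_pos hF le_rfl
  obtain ⟨c, hc, hsq⟩ := hF.exists_pos_le_norm_integral_sq fun x => by
    simpa using (congrFun (schrodingerSol_conj hV E p q) x).symm
  refine ⟨lam / 2, half_pos hlam, fun δ hδ => ?_⟩
  have ha : 0 < c * δ / (4 * C) := by positivity
  have hη : 0 < min (1 / (4 * C ^ 2)) (-E) := lt_min (by positivity) (by linarith)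
  have hηC : 4 * C ^ 2 * min (1 / (4 * C ^ 2)) (-E) ≤ 1 :=
    (le_div_iff₀' (by positivity)).1 (min_le_left _ _)
  obtain ⟨C', hnewton⟩ := exists_newton_error_bound_of_exp_scale (half_pos hlam) hη ha
    (A := (1 + ‖decayRate E‖) * C) (B := (2 - 2 * E) * (2 * C))
  refine ⟨C', ?_⟩
  filter_upwards [hnewton, HasDichotomy.eventually_exp_le_norm_deriv_matching hV hE hdet hlam hC hD
    hc hδ hsq, eventually_ge_atTop 1] with M hnewton hderiv hM hnd
  have hM₀ : 0 ≤ M := zero_le_one.trans hM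
  have hball : ball (E : ℂ) (min (1 / (4 * C ^ 2)) (-E) / M) ⊆ {z | z.re < 0} := fun w hw =>
    re_neg_of_norm_sub_lt <| (mem_ball_iff_norm.1 hw).trans_le <|
      (div_le_self hη.le hM).trans (min_le_right _ _)
  have hbound := fun w hw =>
    (hD M).norm_matching_le_of_mem_ball (w := w) hV hE hdet hM hηC (min_le_right _ _) hw
  have hsmall := (hD M).norm_robin_left_le hM₀ (decayRate E)
  have hrate : 2 * (lam / 2) = lam := by ring
  refine ⟨norm_pos_iff.1 ((mul_pos ha (Real.exp_pos _)).trans_le (hderiv hnd)), ?_⟩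
  rw [neg_mul, hrate] at hnewton
  exact hnewton _ E ((differentiableOn_matching hV hdet hM₀).mono hball) hbound hsmall (hderiv hnd)

end MatchingEstimates

theorem mainTheorem7_general (V : ℝ → ℝ) (hV : Continuous V) (hEven : ∀ x, V (-x) = V x) (ρ T : ℝ)
    (hT : 0 < T) (hper : ∀ x, ρ < x → V (x + T) = V x) (E : ℝ) (hE : E < 0) (Φ : ℝ → ℂ)
    (hΦ : IsBoundState V E Φ) :
    ∃ k : ℝ, 0 < k ∧ ∀ δ : ℝ, 0 < δ → ∃ M₀ C : ℝ, ρ < M₀ ∧ ∀ M : ℝ, M₀ ≤ M →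
      δ * (‖vSol V Φ E M‖ + ‖deriv (vSol V Φ E) M‖) ≤
        ‖deriv (vSol V Φ E) M - Complex.I * sqrtUpper E * vSol V Φ E M‖ →
      ∃ Estar : ℝ, Estar < 0 ∧
        ‖(Estar : ℂ) - E‖ ≤ 1 / M ^ 2 * Real.exp (-k * M) ∧
        Theta V Φ M Estar = 0 ∧
        (∀ z : ℂ, ‖z - E‖ ≤ 1 / M ^ 2 * Real.exp (-k * M) → Theta V Φ M z = 0 → z = Estar) ∧
        (∃ Ψ : ℝ → ℂ, IsBoundState (truncPotential V M) Estar Ψ) ∧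
        DifferentiableAt ℂ (Theta V Φ M) E ∧
        deriv (Theta V Φ M) E ≠ 0 ∧
        ‖(Estar : ℂ) - (E - Theta V Φ M E / deriv (Theta V Φ M) E)‖ ≤
          C * Real.exp (-4 * k * M) := by
  obtain ⟨p, q, r, s, hdet, hpq, hu, hv, hL⟩ := hΦ.exists_initial_data hV hEven
  have hdet' : (p * s - q * r : ℂ) = 1 := mod_cast hdet
  rw [hu] at hL
  obtain ⟨k, hk, hnewton⟩ := exists_newton_error_bound_matching hV hE hdet' hT hper hL
  refine ⟨k, hk, fun δ hδ => ?_⟩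
  obtain ⟨C, hC⟩ := hnewton δ hδ
  obtain ⟨M₀, hM₀⟩ := Filter.eventually_atTop.1 (hC.and (eventually_root_radius_lt hk hE))
  refine ⟨max M₀ (max 1 (ρ + 1)), C, by simp, fun M hM hnd => ?_⟩
  simp only [max_le_iff] at hM
  obtain ⟨hC, hradius⟩ := hM₀ M hM.1
  rw [hv] at hnd
  obtain ⟨hne, huniq, herror⟩ := hC (mul_norm_cauchyData_le_norm_robin hδ.le hnd)
  obtain ⟨e, he, heE, hroot, heuniq⟩ :=
    exists_real_root_of_conj hradius (fun z hz => matching_conj hV p q M hz) huniq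
  rw [Theta_eq_matching hu]
  have hpq' : (p : ℂ) ≠ 0 ∨ (q : ℂ) ≠ 0 := by
    by_contra! h₀
    simp [h₀] at hdet'
  have hM' : 0 < M := one_pos.trans_le hM.2.1
  exact ⟨e, he, heE, hroot, heuniq, exists_isBoundState_of_matching_eq_zero hV hEven
    (mod_cast hpq) hpq' he hM' hroot,
    differentiableAt_of_deriv_ne_zero hne, hne, herror e heE hroot⟩

theorem mainTheorem7 (V : ℝ → ℝ) (ρ : ℝ) (hV : IsDefectPotential V ρ)
    (hEven : ∀ x, V (-x) = V x) (E : ℝ) (hE : E < 0) (Φ : ℝ → ℂ) (hΦ : IsBoundState V E Φ) :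
    ∃ k : ℝ, 0 < k ∧ ∀ δ : ℝ, 0 < δ → ∃ M₀ C : ℝ, ρ < M₀ ∧ ∀ M : ℝ, M₀ ≤ M →
      δ * (‖vSol V Φ E M‖ + ‖deriv (vSol V Φ E) M‖) ≤
        ‖deriv (vSol V Φ E) M - Complex.I * sqrtUpper E * vSol V Φ E M‖ →
      ∃ Estar : ℝ, Estar < 0 ∧
        ‖(Estar : ℂ) - E‖ ≤ 1 / M ^ 2 * Real.exp (-k * M) ∧
        Theta V Φ M Estar = 0 ∧
        (∀ z : ℂ, ‖z - E‖ ≤ 1 / M ^ 2 * Real.exp (-k * M) → Theta V Φ M z = 0 → z = Estar) ∧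
        (∃ Ψ : ℝ → ℂ, IsBoundState (truncPotential V M) Estar Ψ) ∧
        DifferentiableAt ℂ (Theta V Φ M) E ∧
        deriv (Theta V Φ M) E ≠ 0 ∧
        ‖(Estar : ℂ) - (E - Theta V Φ M E / deriv (Theta V Φ M) E)‖ ≤
          C * Real.exp (-4 * k * M) := by
  exact mainTheorem7_general V hV.smooth.continuous hEven ρ 1 one_pos
    (fun _ hx => hV.eventually_periodic hx) E hE Φ hΦ
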